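/- \textbf{Setting.} Let $n\ge 1$ and let $f:\mathbb R^m\times\mathbb R^n\to\mathbb R$ be differentiable with $\ell$-Lipschitz gradient (Euclidean norms) and such that $f(x,\cdot)$ is $\mu$-strongly concave on $\mathbb R^n$ for every $x$, where $\mu>0$; put $\kappa=\ell/\mu$. Let $\mathcal Y\subseteq\mathbb R^n$ be nonempty, convex, closed and bounded with diameter $D$. Put $\Phi(x)=\max_{y\in\mathcal Y}f(x,y)$, let $y^\star(x)$ be the maximizer of $f(x,\cdot)$ over $\mathcal Y$, assume that $\Phi$ is bounded below, and for $x_0\in\mathbb R^m$ put $\Delta_\Phi=\Phi(x_0)-\inf_x\Phi(x)$. Let $G=(G_x,G_y)$ be a stochastic gradient oracle with $\mathbb E[G(x,y,\xi)-\nabla f(x,y)]=0$ and $\mathbb E\|G(x,y,\xi)-\nabla f(x,y)\|^2\le\sigma^2$ for all $(x,y)$, where $\xi$ is a data sample with a fixed law. Let $\epsilon>0$ and put $$\eta_x=\frac1{8\kappa\ell},\qquad \eta_y=\frac1\ell,\qquad \zeta=\frac{\epsilon^2}{6\ell},\qquad M=\Big\lceil\max\Big\{1,\frac{12\kappa\sigma^2}{\epsilon^2}\Big\}\Big\rceil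 .$$ \textbf{SGDmax.} Started at $x_0$, in iteration $t=0,1,\dots$ the max-oracle returns a random point $y_t\in\mathcal Y$ that is $\zeta$-accurate, meaning that almost surely $$\mathbb E[f(x_t,y_t)\mid x_t]\ \ge\ \Phi(x_t)-\zeta\qquad\text{and}\qquad \mathbb E[\|y_t-y^\star(x_t)\|^2\mid x_t]\ \le\ \zeta/\ell ,$$ and then $x_{t+1}=x_t-\eta_x\frac1M\sum_{i=1}^M G_x(x_t,y_t,\xi_{t,i})$ with i.i.d. samples $\xi_{t,1},\dots,\xi_{t,M}$ that are independent of $(x_t,y_t)$. We say that the algorithm returns an $\epsilon$-stationary point of $\Phi$ after $T$ iterations if $\Phi$ is differentiable and $\frac1{T+1}\sum_{t=0}^T\mathbb E\|\nabla\Phi(x_t)\|^2\le\epsilon^2$, that is, $\mathbb E\|\nabla\Phi(\hat x)\|^2\le\epsilon^2$ for $\hat x$ drawn uniformly from $x_0,\dots,x_T$. \textbf{Theorem.} There are universal constants $C,C'>0$ such that in every such setting the following hold. (1) SGDmax returns an $\epsilon$-stationary point of $\Phi$ after every number $T$ of iterations with $T+1\ge C\kappa\ell\Delta_\Phi\epsilon^{-2}$;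 in particular $O(\kappa\ell\Delta_\Phi\epsilon^{-2})$ iterations suffice. (2) For every $z>0$ and $x\in\mathbb R^m$, projected mini-batch stochastic gradient ascent on $f(x,\cdot)$ over $\mathcal Y$, started at any point of $\mathcal Y$, with step size $\eta_y$, batch size $\lceil\max\{1,2\sigma^2\kappa\ell^{-1}z^{-1}\}\rceil$, and $N=\lceil C\kappa\max\{1,\log(\ell D^2/z)\}\rceil$ steps on i.i.d. samples, outputs a point $y_N\in\mathcal Y$ with $\mathbb E f(x,y_N)\ge\Phi(x)-z$ and $\mathbb E\|y_N-y^\star(x)\|^2\le z/\ell$, and it uses at most $C'\kappa\max\{1,\log(\ell D^2/z)\}\max\{1,2\sigma^2\kappa\ell^{-1}z^{-1}\}$ stochastic gradients. (3) Run SGDmax with its max-oracle implemented by the procedure in (2) with $z=\zeta$ and fresh samples; the ascent in iteration $t$ may start at any point of $\mathcal Y$ that is a measurable function of $t$, $x_t$ and $y_{t-1}$, where $y_{-1}\in\mathbb R^n$ is arbitrary. This is a run of SGDmax with a $\zeta$-accurate max-oracle, it returns an $\epsilon$-stationary point of $\Phi$ after $T=\lfloor C\kappa\ell\Delta_\Phi\epsilon^{-2}\rfloor$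 iterations, and the total number of stochastic gradients that it uses in these $T$ iterations is at most $$C'\,\frac{\kappa^2\ell\Delta_\Phi}{\epsilon^2}\,\max\Big\{1,\log\frac{\ell D}{\epsilon}\Big\}\,\max\Big\{1,\frac{\kappa\sigma^2}{\epsilon^2}\Big\}.$$ -/

import Mathlib

open MeasureTheory ProbabilityTheory

noncomputable section

namespace SGDmax

/-- `ℝⁿ` with the Euclidean norm. -/
abbrev Vec (n : ℕ) : Type := EuclideanSpace ℝ (Fin n)

/-- `ℝᵐ⁺ⁿ` with the Euclidean norm; the coordinates are indexed by `Fin m ⊕ Fin n`. -/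
abbrev Joint (m n : ℕ) : Type := EuclideanSpace ℝ (Fin m ⊕ Fin n)

/-- The point `(x, y)` of `ℝᵐ⁺ⁿ`. -/
def pt {m n : ℕ} (x : Vec m) (y : Vec n) : Joint m n := WithLp.toLp 2 (Sum.elim x y)

/-- The `x`-part of a vector of `ℝᵐ⁺ⁿ`. -/
def xPart {m n : ℕ} (z : Joint m n) : Vec m := WithLp.toLp 2 fun i => z (Sum.inl i)

/-- The `y`-part of a vector of `ℝᵐ⁺ⁿ`. -/
def yPart {m n : ℕ} (z : Joint m n) : Vec n := WithLp.toLp 2 fun j => z (Sum.inr j)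

/-- `f` is `ℓ`-smooth: it is differentiable and its gradient is `ℓ`-Lipschitz. -/
structure IsSmooth {m n : ℕ} (ℓ : ℝ) (f : Joint m n → ℝ) : Prop where
  differentiable : Differentiable ℝ f
  lipschitz : ∀ z z' : Joint m n, ‖gradient f z - gradient f z'‖ ≤ ℓ * ‖z - z'‖

/-- The nonconvex-strongly-concave setting: `f` is `ℓ`-smooth, every `f(x, ·)` is `μ`-strongly
concave, `Y` is a nonempty, convex, closed and bounded set, and `x ↦ max_{y ∈ Y} f(x, y)` is
bounded below. -/
structure IsNSC {m n : ℕ} (ℓ μ : ℝ) (f : Joint m n → ℝ) (Y : Set (Vec n)) : Prop where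
  smooth : IsSmooth ℓ f
  mu_pos : 0 < μ
  strongConcave : ∀ x : Vec m, StrongConcaveOn Set.univ μ (fun y => f (pt x y))
  nonempty : Y.Nonempty
  convex : Convex ℝ Y
  closed : IsClosed Y
  bounded : Bornology.IsBounded Y
  bddBelow : BddBelow (Set.range fun x : Vec m => sSup ((fun y => f (pt x y)) '' Y))

/-- `G` is an unbiased stochastic gradient oracle for `f` with variance at most `σ²`; the data
samples have law `𝒟`. -/
structure IsStochOracle {m n : ℕ} {Ξ : Type*} [MeasurableSpace Ξ] (𝒟 : Measure Ξ) (σ : ℝ)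
    (f : Joint m n → ℝ) (G : Joint m n → Ξ → Joint m n) : Prop where
  measurable : Measurable (Function.uncurry G)
  memLp : ∀ z, MemLp (G z) 2 𝒟
  unbiased : ∀ z, ∫ s, (G z s - gradient f z) ∂𝒟 = 0
  variance : ∀ z, ∫ s, ‖G z s - gradient f z‖ ^ 2 ∂𝒟 ≤ σ ^ 2

/-- `Φ(x) = max_{y ∈ Y} f(x, y)`. -/
def Phi {m n : ℕ} (f : Joint m n → ℝ) (Y : Set (Vec n)) (x : Vec m) : ℝ :=
  sSup ((fun y => f (pt x y)) '' Y)

/-- `y⋆(x)`, a point of `Y` at which `f(x, ·)` is maximal over `Y` (unique under strong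
concavity). -/
def yStar {m n : ℕ} (f : Joint m n → ℝ) (Y : Set (Vec n)) (x : Vec m) : Vec n :=
  Classical.epsilon fun y => y ∈ Y ∧ IsMaxOn (fun y' => f (pt x y')) Y y

/-- `Δ_Φ = Φ(x₀) - min Φ`. -/
def gap {m n : ℕ} (f : Joint m n → ℝ) (Y : Set (Vec n)) (x₀ : Vec m) : ℝ :=
  Phi f Y x₀ - ⨅ x, Phi f Y x

/-- Euclidean projection onto `Y`: a point of `Y` nearest to `v` (unique if `Y` is nonempty,
closed and convex). -/
def proj {n : ℕ} (Y : Set (Vec n)) (v : Vec n) : Vec n :=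
  Classical.epsilon fun w => w ∈ Y ∧ ∀ u ∈ Y, ‖v - w‖ ≤ ‖v - u‖

/-- Sum of the stochastic gradients at `z` for the samples `s 0, …, s (M - 1)`, together with the
number of calls of the stochastic gradient `G` made to compute it. -/
def gradSum {m n : ℕ} {Ξ : Type*} (G : Joint m n → Ξ → Joint m n) (z : Joint m n) (s : ℕ → Ξ) :
    ℕ → Joint m n × ℕ
  | 0 => (0, 0)
  | k + 1 => ((gradSum G z s k).1 + G z (s k), (gradSum G z s k).2 + 1)

/-- Mini-batch stochastic gradient `(1/M) ∑_{i < M} G(z, s i)` with its number of calls of `G`. -/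
def miniBatch {m n : ℕ} {Ξ : Type*} (G : Joint m n → Ξ → Joint m n) (M : ℕ) (z : Joint m n)
    (s : ℕ → Ξ) : Joint m n × ℕ :=
  ((M : ℝ)⁻¹ • (gradSum G z s M).1, (gradSum G z s M).2)

/-- Projected mini-batch stochastic gradient ascent on `f(x, ·)` over `Y`, with step size `η`, batch
size `M`, starting point `y₀`, and samples `s j i`, `i < M`, in step `j`: the iterate after the
given number of steps, with the number of calls of `G` made so far. -/
def sga {m n : ℕ} {Ξ : Type*} (G : Joint m n → Ξ → Joint m n) (Y : Set (Vec n)) (η : ℝ) (M : ℕ)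
    (x : Vec m) (y₀ : Vec n) (s : ℕ → ℕ → Ξ) : ℕ → Vec n × ℕ
  | 0 => (y₀, 0)
  | j + 1 =>
    let r := sga G Y η M x y₀ s j
    let b := miniBatch G M (pt x r.1) (s j)
    (proj Y (r.1 + η • yPart b.1), r.2 + b.2)

/-- State of SGDmax with an implemented max-oracle: the current `x_t`, the last output of the
max-oracle, and the number of calls of the stochastic gradient `G` made so far. -/
structure State (m n : ℕ) where
  x : Vec m
  y : Vec n
  calls : ℕ

/-- SGDmax with step size `ηx` and batch size `M`, in which the max-oracle is `N` steps of projected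
mini-batch stochastic gradient ascent with step size `ηy` and batch size `M'`. In iteration `t` the
ascent starts at the point `start t x_t y_{t-1}`, its step `j` uses the samples `s t (j + 1) i`, and
the descent step in `x` uses the samples `s t 0 i`. -/
def sgdmaxSGA {m n : ℕ} {Ξ : Type*} (G : Joint m n → Ξ → Joint m n) (Y : Set (Vec n))
    (ηx ηy : ℝ) (M M' N : ℕ) (start : ℕ → Vec m → Vec n → Vec n) (x₀ : Vec m) (y₀ : Vec n)
    (s : ℕ → ℕ → ℕ → Ξ) : ℕ → State m n
  | 0 => ⟨x₀, y₀, 0⟩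
  | t + 1 =>
    let S := sgdmaxSGA G Y ηx ηy M M' N start x₀ y₀ s t
    let r := sga G Y ηy M' S.x (start t S.x S.y) (fun j => s t (j + 1)) N
    let b := miniBatch G M (pt S.x r.1) (s t 0)
    ⟨S.x - ηx • xPart b.1, r.1, S.calls + r.2 + b.2⟩

/-- `(ξ a)_a` are independent samples with law `𝒟`. -/
structure IsIID {ι Ω Ξ : Type*} [MeasurableSpace Ω] [MeasurableSpace Ξ] (P : Measure Ω)
    (𝒟 : Measure Ξ) (ξ : ι → Ω → Ξ) : Prop where
  measurable : ∀ a, Measurable (ξ a)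
  law : ∀ a, P.map (ξ a) = 𝒟
  indep : iIndepFun ξ P

/-- `(x_t, y_t)` is a run of SGDmax started at `x₀`, with step size `ηx`, batch size `M`, a
`ζ`-accurate max-oracle, and sample batches `ξ t 0, …, ξ t (M - 1)`: each batch is i.i.d. with
law `𝒟` and independent of the current `(x_t, y_t)`; the oracle returns points `y_t` of `Y` with
`𝔼[f(x_t, y_t) | x_t] ≥ max_{y ∈ Y} f(x_t, y) - ζ` and `𝔼[‖y_t - y⋆(x_t)‖² | x_t] ≤ ζ / ℓ`. -/
structure IsRun {m n : ℕ} {Ω Ξ : Type*} [MeasurableSpace Ω] [MeasurableSpace Ξ]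
    (P : Measure Ω) (𝒟 : Measure Ξ) (f : Joint m n → ℝ) (Y : Set (Vec n))
    (G : Joint m n → Ξ → Joint m n) (ℓ ηx ζ : ℝ) (M : ℕ) (x₀ : Vec m)
    (ξ : ℕ → ℕ → Ω → Ξ) (x : ℕ → Ω → Vec m) (y : ℕ → Ω → Vec n) : Prop where
  iid : ∀ t, IsIID P 𝒟 (fun i : Fin M => ξ t i)
  fresh : ∀ t, IndepFun (fun ω => (x t ω, y t ω)) (fun ω (i : Fin M) => ξ t i ω) P
  measurable_x : ∀ t, Measurable (x t)
  measurable_y : ∀ t, Measurable (y t)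
  mem : ∀ t ω, y t ω ∈ Y
  oracle_value : ∀ t, ∀ᵐ ω ∂P, Phi f Y (x t ω) - ζ ≤
    (P[fun ω' => f (pt (x t ω') (y t ω')) | MeasurableSpace.comap (x t) inferInstance]) ω
  oracle_dist : ∀ t, ∀ᵐ ω ∂P,
    (P[fun ω' => ‖y t ω' - yStar f Y (x t ω')‖ ^ 2 |
      MeasurableSpace.comap (x t) inferInstance]) ω ≤ ζ / ℓ
  init : ∀ ω, x 0 ω = x₀
  step : ∀ t ω, x (t + 1) ω =
    x t ω - ηx • xPart (miniBatch G M (pt (x t ω) (y t ω)) (fun i => ξ t i ω)).1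

/-- The point `x̂` drawn uniformly at random from `x_0, …, x_T` (independently of the run) is an
`ε`-stationary point of the differentiable function `Φ` in mean square: `𝔼 ‖∇Φ(x̂)‖² ≤ ε²`. -/
structure ReturnsStationary {m : ℕ} {Ω : Type*} [MeasurableSpace Ω] (P : Measure Ω)
    (Φ : Vec m → ℝ) (ε : ℝ) (x : ℕ → Ω → Vec m) (T : ℕ) : Prop where
  differentiable : Differentiable ℝ Φ
  memLp : ∀ t ≤ T, MemLp (fun ω => gradient Φ (x t ω)) 2 P
  stationary : (∑ t ∈ Finset.range (T + 1), ∫ ω, ‖gradient Φ (x t ω)‖ ^ 2 ∂P) / (T + 1) ≤ ε ^ 2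

end SGDmax

end

/-! Two one-step inequalities carry the proof, one for the ascent in `y` and one for the descent in
`x`; the rest lets random data enter them.

Descent. Since y⋆ is κ-Lipschitz, Φ has around every point a two-sided quadratic expansion with
constant (3/2)κℓ and linear term ∇ₓf(x, y⋆(x)) (`abs_Phi_sub_le`). This is Danskin's formula and the
descent lemma in one. With η = 1/(8κℓ), a step along a noisy ∇ₓf(x_t, y_t) lowers 𝔼Φ by
(η/2)𝔼‖∇Φ(x_t)‖², up to a bias (η/2)ℓ²𝔼‖y_t − y⋆(x_t)‖² and a variance term (3/16)ησ²/M
(`integral_descent_step_le`). The choices of ζ and M make both errors small multiples of ηε², and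
telescoping leaves Δ_Φ/(T+1) to be absorbed (`IsRun.returnsStationary`).

Ascent. Strong concavity, smoothness and the variational inequality of the projection give a step
with the value gap and the squared distance on the left and the squared distance, times 1 − 1/κ, on
the right (`ascent_step`). So distances contract linearly down to a noise floor set by the batch
size, and the last step turns the distance bound into a value bound (`ascent_recursion`).

Noise. In both steps the error splits into a linear part, paired with a vector fixed before the
batch is drawn, and a quadratic part. The first has mean zero (`integral_inner_noise`), the second
is controlled by σ²/M (`memLp_noise`).

Implemented oracle. The state (x_t, y_{t-1}) is a function of earlier samples, hence independent of
those of the next ascent. The ascent guarantee holds for each frozen state, with a bound depending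
on x_t only, so Fubini turns it into a statement about conditional expectations given x_t
(`ae_le_condExp_of_indepFun`). The cost of T iterations is exactly T(NM' + M). -/

namespace SGDmax

open scoped RealInnerProductSpace

/-! ### First-order expansions and the splitting of ℝᵐ⁺ⁿ -/

/-- A differentiable function with `L`-Lipschitz gradient differs from its first-order expansion by
at most `L / 2` times the squared distance. -/
theorem abs_sub_inner_gradient_le {E : Type*} [NormedAddCommGroup E] [InnerProductSpace ℝ E]
    [CompleteSpace E] {f : E → ℝ} {L : ℝ} (hd : Differentiable ℝ f)
    (hl : ∀ z z', ‖gradient f z - gradient f z'‖ ≤ L * ‖z - z'‖) (z z' : E) :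
    |f z' - f z - ⟪gradient f z, z' - z⟫| ≤ L / 2 * ‖z' - z‖ ^ 2 := by
  set d := z' - z with hd'
  have hg : ∀ t : ℝ, HasDerivAt (fun t : ℝ => f (z + t • d) - f z - t * ⟪gradient f z, d⟫)
      (⟪gradient f (z + t • d) - gradient f z, d⟫) t := by
    intro t
    have h1 : HasDerivAt (fun t : ℝ => z + t • d) d t := by
      simpa using ((hasDerivAt_id t).smul_const d).const_add z
    have h2 : HasDerivAt (fun t : ℝ => f (z + t • d)) (fderiv ℝ f (z + t • d) d) t :=
      (hd (z + t • d)).hasFDerivAt.comp_hasDerivAt t h1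
    have h3 : HasDerivAt (fun t : ℝ => t * ⟪gradient f z, d⟫) ⟪gradient f z, d⟫ t := by
      simpa using (hasDerivAt_id t).mul_const ⟪gradient f z, d⟫
    rw [← inner_gradient_left] at h2
    rw [inner_sub_left]
    exact (h2.sub_const (f z)).sub h3
  have hB : ∀ t : ℝ, HasDerivAt (fun t : ℝ => L / 2 * ‖d‖ ^ 2 * t ^ 2) (L * ‖d‖ ^ 2 * t) t := by
    intro t
    refine ((hasDerivAt_pow 2 t).const_mul (L / 2 * ‖d‖ ^ 2)).congr_deriv ?_
    push_cast; ring
  have key := image_norm_le_of_norm_deriv_right_le_deriv_boundary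
    (f := fun t : ℝ => f (z + t • d) - f z - t * ⟪gradient f z, d⟫) (a := 0) (b := 1)
    (f' := fun t => ⟪gradient f (z + t • d) - gradient f z, d⟫)
    (fun t _ => (hg t).continuousAt.continuousWithinAt)
    (fun t _ => (hg t).hasDerivWithinAt)
    (B := fun t : ℝ => L / 2 * ‖d‖ ^ 2 * t ^ 2) (B' := fun t => L * ‖d‖ ^ 2 * t)
    (by simp) hB (by
      intro t ht
      refine (norm_inner_le_norm _ _).trans ?_
      have := hl (z + t • d) z
      rw [add_sub_cancel_left, norm_smul, Real.norm_of_nonneg ht.1] at this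
      calc _ ≤ L * (t * ‖d‖) * ‖d‖ := by gcongr
        _ = _ := by ring) (x := 1) (by simp)
  simpa [hd'] using key

/-- Stands in for letting t → 0 after dividing a first-order inequality along a segment by t. If A
were positive, t = A/(A + K) would violate the hypothesis. -/
theorem nonpos_of_forall_le_mul {A K : ℝ} (h : ∀ t : ℝ, 0 < t → t ≤ 1 → A ≤ t * K) : A ≤ 0 := by
  by_contra! hA
  have hK : 0 < K := by have := h 1 one_pos le_rfl; linarith
  have ht : 0 < A / (A + K) := by positivity
  have := h (A / (A + K)) ht (by rw [div_le_one (by positivity)]; linarith)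
  rw [div_mul_eq_mul_div, le_div_iff₀ (by positivity)] at this
  nlinarith

variable {m n : ℕ}

@[simp] theorem xPart_pt (x : Vec m) (y : Vec n) : xPart (pt x y) = x := rfl

@[simp] theorem yPart_pt (x : Vec m) (y : Vec n) : yPart (pt x y) = y := rfl

@[simp] theorem xPart_add (z z' : Joint m n) : xPart (z + z') = xPart z + xPart z' := rfl
@[simp] theorem yPart_add (z z' : Joint m n) : yPart (z + z') = yPart z + yPart z' := rfl
@[simp] theorem xPart_sub (z z' : Joint m n) : xPart (z - z') = xPart z - xPart z' := rfl
@[simp] theorem yPart_sub (z z' : Joint m n) : yPart (z - z') = yPart z - yPart z' := rfl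

theorem inner_eq_parts (z z' : Joint m n) :
    ⟪z, z'⟫ = ⟪xPart z, xPart z'⟫ + ⟪yPart z, yPart z'⟫ := by
  simp [PiLp.inner_apply, Fintype.sum_sum_type, xPart, yPart]

theorem norm_sq_eq_parts (z : Joint m n) : ‖z‖ ^ 2 = ‖xPart z‖ ^ 2 + ‖yPart z‖ ^ 2 := by
  simp only [← real_inner_self_eq_norm_sq, inner_eq_parts]

theorem norm_xPart_le (z : Joint m n) : ‖xPart z‖ ≤ ‖z‖ := by
  have := norm_sq_eq_parts z
  exact abs_le_of_sq_le_sq' (by nlinarith [sq_nonneg ‖yPart z‖]) (norm_nonneg _) |>.2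

theorem norm_yPart_le (z : Joint m n) : ‖yPart z‖ ≤ ‖z‖ := by
  have := norm_sq_eq_parts z
  exact abs_le_of_sq_le_sq' (by nlinarith [sq_nonneg ‖xPart z‖]) (norm_nonneg _) |>.2

@[fun_prop] theorem continuous_xPart : Continuous (xPart : Joint m n → Vec m) := by
  unfold xPart; fun_prop

@[fun_prop] theorem continuous_yPart : Continuous (yPart : Joint m n → Vec n) := by
  unfold yPart; fun_prop

@[fun_prop] theorem measurable_xPart : Measurable (xPart : Joint m n → Vec m) :=
  continuous_xPart.measurable

@[fun_prop] theorem measurable_yPart : Measurable (yPart : Joint m n → Vec n) :=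
  continuous_yPart.measurable

@[fun_prop] theorem continuous_pt {α : Type*} [TopologicalSpace α] {u : α → Vec m} {v : α → Vec n}
    (hu : Continuous u) (hv : Continuous v) : Continuous fun a => pt (u a) (v a) := by
  unfold pt
  refine (PiLp.continuous_toLp 2 _).comp (continuous_pi fun i => ?_)
  cases i <;> simp <;> fun_prop

@[fun_prop] theorem measurable_pt {α : Type*} {mα : MeasurableSpace α} {u : α → Vec m} {v : α → Vec n}
    (hu : Measurable u) (hv : Measurable v) : Measurable fun a => pt (u a) (v a) :=
  (continuous_pt (m := m) (n := n) continuous_fst continuous_snd).measurable.comp (hu.prodMk hv)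

theorem norm_pt_sub_left (x x' : Vec m) (y : Vec n) : ‖pt x y - pt x' y‖ = ‖x - x'‖ := by
  have := norm_sq_eq_parts (pt x y - pt x' y)
  simp only [xPart_sub, xPart_pt, yPart_sub, yPart_pt, sub_self, norm_zero] at this
  exact (sq_eq_sq₀ (norm_nonneg _) (norm_nonneg _)).1 (by simpa using this)

theorem norm_pt_sub_right (x : Vec m) (y y' : Vec n) : ‖pt x y - pt x y'‖ = ‖y - y'‖ := by
  have := norm_sq_eq_parts (pt x y - pt x y')
  simp only [xPart_sub, xPart_pt, yPart_sub, yPart_pt, sub_self, norm_zero] at this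
  exact (sq_eq_sq₀ (norm_nonneg _) (norm_nonneg _)).1 (by simpa using this)

theorem IsSmooth.continuous_gradient {ℓ : ℝ} {f : Joint m n → ℝ} (h : IsSmooth ℓ f) :
    Continuous (gradient f) :=
  (LipschitzWith.of_dist_le_mul (K := ℓ.toNNReal) fun z z' => by
    rw [dist_eq_norm, dist_eq_norm]
    exact (h.lipschitz z z').trans
      (mul_le_mul_of_nonneg_right (Real.le_coe_toNNReal ℓ) (norm_nonneg _))).continuous

theorem IsSmooth.abs_sub_left_le {ℓ : ℝ} {f : Joint m n → ℝ} (h : IsSmooth ℓ f)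
    (x x' : Vec m) (y : Vec n) :
    |f (pt x' y) - f (pt x y) - ⟪xPart (gradient f (pt x y)), x' - x⟫| ≤
      ℓ / 2 * ‖x' - x‖ ^ 2 := by
  have := abs_sub_inner_gradient_le h.differentiable h.lipschitz (pt x y) (pt x' y)
  rw [norm_pt_sub_left, inner_eq_parts] at this
  simpa using this

theorem IsSmooth.abs_sub_right_le {ℓ : ℝ} {f : Joint m n → ℝ} (h : IsSmooth ℓ f)
    (x : Vec m) (y y' : Vec n) :
    |f (pt x y') - f (pt x y) - ⟪yPart (gradient f (pt x y)), y' - y⟫| ≤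
      ℓ / 2 * ‖y' - y‖ ^ 2 := by
  have := abs_sub_inner_gradient_le h.differentiable h.lipschitz (pt x y) (pt x y')
  rw [norm_pt_sub_right, inner_eq_parts] at this
  simpa using this

/-! ### Deterministic geometry: y⋆, Φ, the projection and one ascent step -/

namespace IsNSC

variable {ℓ μ : ℝ} {f : Joint m n → ℝ} {Y : Set (Vec n)}

theorem le_sub_quadratic (h : IsNSC ℓ μ f Y) (x : Vec m) (y u : Vec n) :
    f (pt x u) ≤ f (pt x y) + ⟪yPart (gradient f (pt x y)), u - y⟫ - μ / 2 * ‖u - y‖ ^ 2 := by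
  set g := yPart (gradient f (pt x y))
  suffices f (pt x u) - f (pt x y) - ⟪g, u - y⟫ + μ / 2 * ‖u - y‖ ^ 2 ≤ 0 by linarith
  -- `K` collects the terms of order t²: ℓ/2 from smoothness and μ/2 from the factor t(1 − t) in
  -- strong concavity.
  refine nonpos_of_forall_le_mul (K := (ℓ + μ) / 2 * ‖u - y‖ ^ 2) fun t ht ht1 => ?_
  have h1 := (h.strongConcave x).2 (Set.mem_univ y) (Set.mem_univ u)
    (sub_nonneg.2 ht1) ht.le (by ring)
  have h2 := (abs_le.1 (h.smooth.abs_sub_right_le x y ((1 - t) • y + t • u))).2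
  have e : (1 - t) • y + t • u - y = t • (u - y) := by module
  rw [e, inner_smul_right, norm_smul, Real.norm_of_nonneg ht.le, mul_pow] at h2
  simp only [smul_eq_mul, norm_sub_rev y u] at h1
  have h3 : t * (f (pt x u) - f (pt x y) - ⟪g, u - y⟫ + μ / 2 * ‖u - y‖ ^ 2) ≤
      t * (t * ((ℓ + μ) / 2 * ‖u - y‖ ^ 2)) := by
    simp only [g]
    linarith
  exact le_of_mul_le_mul_left h3 ht

/-- Along a unit vector the curvature bounds from strong concavity and from smoothness face each
other; a unit vector exists only for n > 0. This is where κ ≥ 1 comes from. -/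
theorem mu_le (h : IsNSC ℓ μ f Y) (hn : 0 < n) : μ ≤ ℓ := by
  have h1 := h.le_sub_quadratic 0 0 (EuclideanSpace.single ⟨0, hn⟩ 1)
  have h2 := (abs_le.1 (h.smooth.abs_sub_right_le 0 0 (EuclideanSpace.single ⟨0, hn⟩ 1))).1
  simp only [sub_zero, PiLp.norm_single, norm_one] at h1 h2
  linarith

theorem isCompact (h : IsNSC ℓ μ f Y) : IsCompact Y :=
  Metric.isCompact_of_isClosed_isBounded h.closed h.bounded

theorem continuous (h : IsNSC ℓ μ f Y) : Continuous f := h.smooth.differentiable.continuous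

theorem yStar_spec (h : IsNSC ℓ μ f Y) (x : Vec m) :
    yStar f Y x ∈ Y ∧ IsMaxOn (fun y' => f (pt x y')) Y (yStar f Y x) := by
  have hc : Continuous fun y' : Vec n => f (pt x y') := h.continuous.comp (by fun_prop)
  obtain ⟨y, hy, hm⟩ := h.isCompact.exists_isMaxOn h.nonempty hc.continuousOn
  exact Classical.epsilon_spec (p := fun y => y ∈ Y ∧ IsMaxOn (fun y' => f (pt x y')) Y y)
    ⟨y, hy, hm⟩

theorem yStar_mem (h : IsNSC ℓ μ f Y) (x : Vec m) : yStar f Y x ∈ Y := (h.yStar_spec x).1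

theorem le_yStar (h : IsNSC ℓ μ f Y) (x : Vec m) {u : Vec n} (hu : u ∈ Y) :
    f (pt x u) ≤ f (pt x (yStar f Y x)) := (h.yStar_spec x).2 hu

theorem Phi_eq (h : IsNSC ℓ μ f Y) (x : Vec m) : Phi f Y x = f (pt x (yStar f Y x)) := by
  refine IsGreatest.csSup_eq ⟨⟨_, h.yStar_mem x, rfl⟩, ?_⟩
  rintro _ ⟨u, hu, rfl⟩
  exact h.le_yStar x hu

theorem inner_yStar_nonpos (h : IsNSC ℓ μ f Y) (x : Vec m) {u : Vec n} (hu : u ∈ Y) :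
    ⟪yPart (gradient f (pt x (yStar f Y x))), u - yStar f Y x⟫ ≤ 0 := by
  set y := yStar f Y x
  refine nonpos_of_forall_le_mul (K := ℓ / 2 * ‖u - y‖ ^ 2) fun t ht ht1 => ?_
  have h1 := h.le_yStar x (h.convex (h.yStar_mem x) hu (sub_nonneg.2 ht1) ht.le (by ring))
  have h2 := (abs_le.1 (h.smooth.abs_sub_right_le x y ((1 - t) • y + t • u))).1
  have e : (1 - t) • y + t • u - y = t • (u - y) := by module
  rw [e, inner_smul_right, norm_smul, Real.norm_of_nonneg ht.le, mul_pow] at h2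
  refine le_of_mul_le_mul_left ?_ ht
  linarith

/-- The gradient at a constrained maximizer need not vanish, but its inner product with feasible
directions is nonpositive, so the linear term only helps. -/
theorem quadratic_growth (h : IsNSC ℓ μ f Y) (x : Vec m) {u : Vec n} (hu : u ∈ Y) :
    μ / 2 * ‖u - yStar f Y x‖ ^ 2 ≤ Phi f Y x - f (pt x u) := by
  have h1 := h.le_sub_quadratic x (yStar f Y x) u
  have h2 := h.inner_yStar_nonpos x hu
  rw [h.Phi_eq]
  linarith

/-- Test the optimality condition of each maximizer with the other one and add both strong concavity
inequalities at x'. This leaves μ‖y' − y‖² against a change of ∇_y f caused by moving x alone. -/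
theorem norm_yStar_sub_le (h : IsNSC ℓ μ f Y) (x x' : Vec m) :
    ‖yStar f Y x' - yStar f Y x‖ ≤ ℓ / μ * ‖x' - x‖ := by
  set y := yStar f Y x
  set y' := yStar f Y x'
  have hμ := h.mu_pos
  have a1 := h.inner_yStar_nonpos x (h.yStar_mem x')
  have a2 := h.inner_yStar_nonpos x' (h.yStar_mem x)
  have b1 := h.le_sub_quadratic x y y'
  have b2 := h.le_sub_quadratic x y' y
  rw [norm_sub_rev y y'] at b2
  have e : y - y' = -(y' - y) := by abel
  rw [e, inner_neg_right] at b2 a2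
  have c : ⟪yPart (gradient f (pt x' y')) - yPart (gradient f (pt x y')), y' - y⟫ ≤
      ℓ * ‖x' - x‖ * ‖y' - y‖ := by
    refine (real_inner_le_norm _ _).trans (mul_le_mul_of_nonneg_right ?_ (norm_nonneg _))
    rw [← yPart_sub, ← norm_pt_sub_left x' x y']
    exact (norm_yPart_le _).trans (h.smooth.lipschitz _ _)
  rw [inner_sub_left] at c
  have k : μ * ‖y' - y‖ * ‖y' - y‖ ≤ ℓ * ‖x' - x‖ * ‖y' - y‖ := by nlinarith
  rw [div_mul_eq_mul_div, le_div_iff₀ hμ]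
  rcases (norm_nonneg (y' - y)).eq_or_lt with h0 | h0
  · have hl : 0 ≤ ℓ * ‖x' - x‖ := by
      rw [← norm_pt_sub_left x' x y']
      exact (norm_nonneg _).trans (h.smooth.lipschitz _ _)
    rw [← h0]; simpa using hl
  · linarith [le_of_mul_le_mul_right k h0]

theorem norm_xPart_gradient_sub_le (h : IsNSC ℓ μ f Y) (x : Vec m) (y y' : Vec n) :
    ‖xPart (gradient f (pt x y)) - xPart (gradient f (pt x y'))‖ ≤ ℓ * ‖y - y'‖ := by
  rw [← xPart_sub, ← norm_pt_sub_right x y y']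
  exact (norm_xPart_le _).trans (h.smooth.lipschitz _ _)

/-- From below, insert y⋆(x) into Φ(x'). From above, expand f(·, y⋆(x')) and replace its gradient at
x by the one at y⋆(x), at cost κℓ‖x' − x‖². With ℓ/2 ≤ κℓ/2 this makes 3/2. -/
theorem abs_Phi_sub_le (h : IsNSC ℓ μ f Y) (hn : 0 < n) (x x' : Vec m) :
    |Phi f Y x' - Phi f Y x - ⟪xPart (gradient f (pt x (yStar f Y x))), x' - x⟫| ≤
      3 / 2 * (ℓ / μ * ℓ) * ‖x' - x‖ ^ 2 := by
  have hμ := h.mu_pos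
  have hℓ := hμ.trans_le (h.mu_le hn)
  set y := yStar f Y x
  set y' := yStar f Y x'
  have hκ : ℓ ≤ ℓ / μ * ℓ := le_mul_of_one_le_left hℓ.le ((one_le_div hμ).2 (h.mu_le hn))
  have a1 := (abs_le.1 (h.smooth.abs_sub_left_le x x' y)).1
  have a2 := (abs_le.1 (h.smooth.abs_sub_left_le x x' y')).2
  have b1 := h.le_yStar x (h.yStar_mem x')
  have b2 := h.le_yStar x' (h.yStar_mem x)
  have c : ⟪xPart (gradient f (pt x y')) - xPart (gradient f (pt x y)), x' - x⟫ ≤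
      ℓ * (ℓ / μ * ‖x' - x‖) * ‖x' - x‖ := by
    refine (real_inner_le_norm _ _).trans (mul_le_mul_of_nonneg_right ?_ (norm_nonneg _))
    exact (h.norm_xPart_gradient_sub_le x y' y).trans
      (mul_le_mul_of_nonneg_left (h.norm_yStar_sub_le x x') hℓ.le)
  rw [inner_sub_left] at c
  rw [h.Phi_eq, h.Phi_eq]
  have hs := mul_le_mul_of_nonneg_right hκ (sq_nonneg ‖x' - x‖)
  have hp : 0 ≤ ℓ * ‖x' - x‖ ^ 2 := by positivity
  have e : ℓ * (ℓ / μ * ‖x' - x‖) * ‖x' - x‖ = ℓ / μ * ℓ * ‖x' - x‖ ^ 2 := by ring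
  rw [e] at c
  rw [abs_le]
  constructor <;> linarith

theorem hasGradientAt_Phi (h : IsNSC ℓ μ f Y) (hn : 0 < n) (x : Vec m) :
    HasGradientAt (Phi f Y) (xPart (gradient f (pt x (yStar f Y x)))) x := by
  rw [hasGradientAt_iff_isLittleO]
  refine Asymptotics.IsBigO.trans_isLittleO (g := fun x' => ‖x' - x‖ ^ 2) ?_ ?_
  · refine Asymptotics.IsBigO.of_bound (3 / 2 * (ℓ / μ * ℓ)) (Filter.Eventually.of_forall ?_)
    intro x'
    simpa using h.abs_Phi_sub_le hn x x'
  · have : (fun x' : Vec m => ‖x' - x‖ ^ 2) =o[nhds x] fun x' => ‖x' - x‖ ^ 1 := by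
      refine Asymptotics.IsLittleO.comp_tendsto (k := fun x' : Vec m => ‖x' - x‖) (l' := nhds x)
        (Asymptotics.isLittleO_pow_pow (𝕜 := ℝ) one_lt_two) ?_
      have : Continuous fun x' : Vec m => ‖x' - x‖ := by fun_prop
      simpa using this.tendsto x
    simpa using this.norm_right

theorem gradient_Phi (h : IsNSC ℓ μ f Y) (hn : 0 < n) (x : Vec m) :
    gradient (Phi f Y) x = xPart (gradient f (pt x (yStar f Y x))) :=
  (h.hasGradientAt_Phi hn x).gradient

theorem continuous_Phi (h : IsNSC ℓ μ f Y) (hn : 0 < n) : Continuous (Phi f Y) :=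
  continuous_iff_continuousAt.2 fun x => (h.hasGradientAt_Phi hn x).continuousAt

theorem continuous_yStar (h : IsNSC ℓ μ f Y) : Continuous (yStar f Y) :=
  (LipschitzWith.of_dist_le_mul (K := (ℓ / μ).toNNReal) fun z z' => by
    rw [dist_eq_norm, dist_eq_norm]
    exact (h.norm_yStar_sub_le z' z).trans
      (mul_le_mul_of_nonneg_right (Real.le_coe_toNNReal _) (norm_nonneg _))).continuous

theorem gap_nonneg (h : IsNSC ℓ μ f Y) (x : Vec m) : 0 ≤ gap f Y x :=
  sub_nonneg.2 (ciInf_le h.bddBelow x)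

theorem proj_spec (h : IsNSC ℓ μ f Y) (v : Vec n) :
    proj Y v ∈ Y ∧ ∀ u ∈ Y, ‖v - proj Y v‖ ≤ ‖v - u‖ := by
  obtain ⟨w, hw, hm⟩ := h.isCompact.exists_isMinOn (f := fun u => ‖v - u‖) h.nonempty
    (by fun_prop)
  exact Classical.epsilon_spec (p := fun w => w ∈ Y ∧ ∀ u ∈ Y, ‖v - w‖ ≤ ‖v - u‖)
    ⟨w, hw, fun u hu => hm hu⟩

theorem proj_mem (h : IsNSC ℓ μ f Y) (v : Vec n) : proj Y v ∈ Y := (h.proj_spec v).1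

theorem inner_proj_nonpos (h : IsNSC ℓ μ f Y) (v : Vec n) {u : Vec n} (hu : u ∈ Y) :
    ⟪v - proj Y v, u - proj Y v⟫ ≤ 0 := by
  refine (norm_eq_iInf_iff_real_inner_le_zero h.convex (h.proj_mem v)).1 ?_ u hu
  have : Nonempty Y := h.nonempty.to_subtype
  refine le_antisymm (le_ciInf fun w => (h.proj_spec v).2 w w.2) ?_
  exact ciInf_le ⟨0, by rintro _ ⟨w, rfl⟩; exact norm_nonneg _⟩ (⟨_, h.proj_mem v⟩ : Y)

theorem norm_proj_sub_le (h : IsNSC ℓ μ f Y) (v w : Vec n) :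
    ‖proj Y v - proj Y w‖ ≤ ‖v - w‖ := by
  set p := proj Y v
  set q := proj Y w
  have a := h.inner_proj_nonpos v (h.proj_mem w)
  have b := h.inner_proj_nonpos w (h.proj_mem v)
  have e : ‖p - q‖ * ‖p - q‖ ≤ ‖v - w‖ * ‖p - q‖ := by
    refine le_trans ?_ (real_inner_le_norm _ _)
    rw [← real_inner_self_eq_norm_mul_norm]
    have e1 : q - p = -(p - q) := by abel
    rw [show proj Y w - proj Y v = -(p - q) from e1, inner_neg_right] at a
    have e2 : ⟪v - w, p - q⟫ = ⟪v - p, p - q⟫ - ⟪w - q, p - q⟫ + ⟪p - q, p - q⟫ := by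
      rw [← inner_sub_left, ← inner_add_left]; congr 1; abel
    rw [e2]
    change -⟪v - p, p - q⟫ ≤ 0 at a
    change ⟪w - q, p - q⟫ ≤ 0 at b
    linarith
  rcases (norm_nonneg (p - q)).eq_or_lt with h0 | h0
  · rw [← h0]; exact norm_nonneg _
  · exact le_of_mul_le_mul_right e h0

theorem continuous_proj (h : IsNSC ℓ μ f Y) : Continuous (proj Y) :=
  (LipschitzWith.of_dist_le_mul (K := 1) fun v w => by
    simpa [dist_eq_norm] using h.norm_proj_sub_le v w).continuous

/-- One step of projected gradient ascent from `y` with step size `1 / ℓ` and a gradient perturbed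
by `w`. The error term is split into a part linear in `w` and a part quadratic in `w`. -/
theorem ascent_step (h : IsNSC ℓ μ f Y) (hn : 0 < n) (x : Vec m) (y w : Vec n) :
    Phi f Y x - f (pt x (proj Y (y + (1 / ℓ) • (yPart (gradient f (pt x y)) + w)))) +
      ℓ / 2 * ‖proj Y (y + (1 / ℓ) • (yPart (gradient f (pt x y)) + w)) - yStar f Y x‖ ^ 2 ≤
    (ℓ - μ) / 2 * ‖y - yStar f Y x‖ ^ 2 +
      ⟪proj Y (y + (1 / ℓ) • yPart (gradient f (pt x y))) - yStar f Y x, w⟫ +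
      1 / ℓ * ‖w‖ ^ 2 := by
  have hℓ := h.mu_pos.trans_le (h.mu_le hn)
  set g := yPart (gradient f (pt x y))
  set u := yStar f Y x
  set p := proj Y (y + (1 / ℓ) • (g + w)) with hp
  set q := proj Y (y + (1 / ℓ) • g) with hq
  have a := h.le_sub_quadratic x y u
  have b := (abs_le.1 (h.smooth.abs_sub_right_le x y p)).1
  have c := h.inner_proj_nonpos (y + (1 / ℓ) • (g + w)) (h.yStar_mem x)
  rw [← hp, show yStar f Y x = u from rfl] at c
  have e1 : ⟪y + (1 / ℓ) • (g + w) - p, u - p⟫ =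
      ⟪y - p, u - p⟫ + 1 / ℓ * (⟪g, u - p⟫ + ⟪w, u - p⟫) := by
    rw [← inner_add_left, ← real_inner_smul_left, ← inner_add_left]; congr 1; abel
  have e2 : 2 * ⟪y - p, u - p⟫ = ‖y - p‖ ^ 2 + ‖u - p‖ ^ 2 - ‖y - u‖ ^ 2 := by
    have := norm_sub_sq_real (y - p) (u - p)
    rw [sub_sub_sub_cancel_right] at this
    linarith
  rw [e1] at c
  have c' : ℓ * ⟪y - p, u - p⟫ + (⟪g, u - p⟫ + ⟪w, u - p⟫) ≤ 0 := by
    have := mul_le_mul_of_nonneg_left c hℓ.le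
    field_simp at this
    linarith
  have e3 : ⟪g, u - p⟫ = ⟪g, u - y⟫ - ⟪g, p - y⟫ := by rw [← inner_sub_right]; congr 1; abel
  -- Going through the noise-free projection `q` leaves a linear term whose coefficient does not
  -- depend on `w`; the remainder is quadratic in `w` since the projection is nonexpansive.
  have e4 : ⟪w, u - p⟫ = - ⟪q - u, w⟫ - ⟪w, p - q⟫ := by
    rw [real_inner_comm w (q - u), ← inner_neg_right, ← inner_sub_right]; congr 1; abel
  have e5 : ⟪w, p - q⟫ ≤ 1 / ℓ * ‖w‖ ^ 2 := by
    have := h.norm_proj_sub_le (y + (1 / ℓ) • (g + w)) (y + (1 / ℓ) • g)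
    have e : y + (1 / ℓ) • (g + w) - (y + (1 / ℓ) • g) = (1 / ℓ) • w := by module
    rw [e, norm_smul, Real.norm_of_nonneg (by positivity), ← hp, ← hq] at this
    calc _ ≤ ‖w‖ * ‖p - q‖ := real_inner_le_norm _ _
      _ ≤ ‖w‖ * (1 / ℓ * ‖w‖) := by gcongr
      _ = _ := by ring
  rw [h.Phi_eq, norm_sub_rev p u]
  rw [norm_sub_rev u y] at a
  rw [norm_sub_rev p y] at b
  change f (pt x u) ≤ f (pt x y) + ⟪g, u - y⟫ - μ / 2 * ‖y - u‖ ^ 2 at a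
  change -(ℓ / 2 * ‖y - p‖ ^ 2) ≤ f (pt x p) - f (pt x y) - ⟪g, p - y⟫ at b
  change f (pt x u) - f (pt x p) + ℓ / 2 * ‖u - p‖ ^ 2 ≤ _
  nlinarith

end IsNSC

/-! ### Freezing an independent variable: Fubini and conditional expectations -/

section Independence

variable {Ω α β : Type*} [MeasurableSpace Ω] [MeasurableSpace α] [MeasurableSpace β]
  {P : Measure Ω} [IsProbabilityMeasure P] {U : Ω → α} {V : Ω → β}

theorem integrable_prod_of_indepFun (hUV : IndepFun U V P) (hU : Measurable U) (hV : Measurable V)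
    {F : α × β → ℝ} (hF : Measurable F) (hi : Integrable (fun ω => F (U ω, V ω)) P) :
    Integrable F ((P.map U).prod (P.map V)) := by
  rw [← hUV.map_prod_eq_prod_map_map hU.aemeasurable hV.aemeasurable]
  exact (integrable_map_measure hF.aestronglyMeasurable (hU.prodMk hV).aemeasurable).2 hi

theorem integral_eq_integral_integral_of_indepFun (hUV : IndepFun U V P) (hU : Measurable U)
    (hV : Measurable V) {F : α × β → ℝ} (hF : Measurable F)
    (hi : Integrable (fun ω => F (U ω, V ω)) P) :
    ∫ ω, F (U ω, V ω) ∂P = ∫ ω, ∫ ω', F (U ω, V ω') ∂P ∂P := by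
  have hp := integrable_prod_of_indepFun hUV hU hV hF hi
  have : IsProbabilityMeasure (P.map V) := Measure.isProbabilityMeasure_map hV.aemeasurable
  have hm : StronglyMeasurable fun u => ∫ v, F (u, v) ∂(P.map V) :=
    hF.stronglyMeasurable.integral_prod_right'
  calc ∫ ω, F (U ω, V ω) ∂P = ∫ p, F p ∂(P.map fun ω => (U ω, V ω)) :=
        (integral_map (hU.prodMk hV).aemeasurable hF.aestronglyMeasurable).symm
    _ = ∫ u, ∫ v, F (u, v) ∂(P.map V) ∂(P.map U) := by
        rw [hUV.map_prod_eq_prod_map_map hU.aemeasurable hV.aemeasurable, integral_prod _ hp]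
    _ = ∫ ω, ∫ v, F (U ω, v) ∂(P.map V) ∂P :=
        integral_map hU.aemeasurable hm.aestronglyMeasurable
    _ = _ := by
        congr 1; ext ω
        exact integral_map hV.aemeasurable
          (hF.comp measurable_prodMk_left).aestronglyMeasurable

theorem integrable_integral_of_indepFun (hUV : IndepFun U V P) (hU : Measurable U)
    (hV : Measurable V) {F : α × β → ℝ} (hF : Measurable F)
    (hi : Integrable (fun ω => F (U ω, V ω)) P) :
    Integrable (fun ω => ∫ ω', F (U ω, V ω') ∂P) P := by
  have hp := (integrable_prod_of_indepFun hUV hU hV hF hi).integral_prod_left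
  have := (integrable_map_measure hp.1 hU.aemeasurable).1 hp
  refine this.congr (Filter.Eventually.of_forall fun ω => ?_)
  exact integral_map hV.aemeasurable (hF.comp measurable_prodMk_left).aestronglyMeasurable

/-- A bound uniform in the frozen value u passes to the random `U`. Integrability is not known
beforehand, so Tonelli for the nonnegative `F` comes first. -/
theorem integrable_and_integral_le_of_indepFun (hUV : IndepFun U V P) (hU : Measurable U)
    (hV : Measurable V) {F : α × β → ℝ} (hF : Measurable F) (h0 : ∀ p, 0 ≤ F p) {c : ℝ}
    (hi : ∀ u, Integrable (fun ω => F (u, V ω)) P) (hc : ∀ u, ∫ ω, F (u, V ω) ∂P ≤ c) :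
    Integrable (fun ω => F (U ω, V ω)) P ∧ ∫ ω, F (U ω, V ω) ∂P ≤ c := by
  have : IsProbabilityMeasure (P.map V) := Measure.isProbabilityMeasure_map hV.aemeasurable
  have hI : Integrable (fun ω => F (U ω, V ω)) P := by
    refine ⟨(hF.comp (hU.prodMk hV)).aestronglyMeasurable, ?_⟩
    rw [hasFiniteIntegral_iff_ofReal (Filter.Eventually.of_forall fun _ => h0 _)]
    have hFm : Measurable fun p => ENNReal.ofReal (F p) := hF.ennreal_ofReal
    calc ∫⁻ ω, ENNReal.ofReal (F (U ω, V ω)) ∂P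
        = ∫⁻ p, ENNReal.ofReal (F p) ∂(P.map fun ω => (U ω, V ω)) :=
          (lintegral_map hFm (hU.prodMk hV)).symm
      _ = ∫⁻ u, ∫⁻ v, ENNReal.ofReal (F (u, v)) ∂(P.map V) ∂(P.map U) := by
          rw [hUV.map_prod_eq_prod_map_map hU.aemeasurable hV.aemeasurable,
            lintegral_prod _ hFm.aemeasurable]
      _ ≤ ∫⁻ _, ENNReal.ofReal c ∂(P.map U) := by
          refine lintegral_mono fun u => ?_
          rw [lintegral_map (f := fun v => ENNReal.ofReal (F (u, v)))
            (hFm.comp measurable_prodMk_left) hV,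
            ← ofReal_integral_eq_lintegral_ofReal (hi u)
              (Filter.Eventually.of_forall fun _ => h0 _)]
          exact ENNReal.ofReal_le_ofReal (hc u)
      _ < ⊤ := by
          rw [lintegral_const, Measure.map_apply hU MeasurableSet.univ]
          simp
  refine ⟨hI, ?_⟩
  rw [integral_eq_integral_integral_of_indepFun hUV hU hV hF hI]
  calc _ ≤ ∫ _, c ∂P := integral_mono (integrable_integral_of_indepFun hUV hU hV hF hI)
        (integrable_const c) fun ω => hc (U ω)
    _ = c := by simp

theorem ae_le_condExp_comap {F : Ω → ℝ} {g : α → ℝ} {X : Ω → α} (hX : Measurable X)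
    (hF : Integrable F P) (hg : Measurable g) (hgX : Integrable (fun ω => g (X ω)) P)
    (hle : ∀ A, MeasurableSet A → ∫ ω in X ⁻¹' A, g (X ω) ∂P ≤ ∫ ω in X ⁻¹' A, F ω ∂P) :
    ∀ᵐ ω ∂P, g (X ω) ≤ (P[F | MeasurableSpace.comap X inferInstance]) ω := by
  have hm : MeasurableSpace.comap X inferInstance ≤ (inferInstance : MeasurableSpace Ω) :=
    hX.comap_le
  have hgm : StronglyMeasurable[MeasurableSpace.comap X inferInstance] fun ω => g (X ω) :=
    (hg.comp (comap_measurable X)).stronglyMeasurable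
  refine ae_le_of_ae_le_trim (hm := hm) ?_
  refine ae_le_of_forall_setIntegral_le (hgX.trim hm hgm)
    (integrable_condExp.trim hm stronglyMeasurable_condExp) ?_
  rintro _ ⟨A, hA, rfl⟩ -
  have hA' : MeasurableSet[MeasurableSpace.comap X inferInstance] (X ⁻¹' A) := ⟨A, hA, rfl⟩
  rw [← setIntegral_trim hm hgm hA', ← setIntegral_trim hm stronglyMeasurable_condExp hA',
    setIntegral_condExp hm hF hA']
  exact hle A hA

/-- The state `U` may carry more information than the conditioning variable `p U`. Since the bound
for frozen u depends on `p u` only, it survives averaging over the rest. -/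
theorem ae_le_condExp_of_indepFun {γ : Type*} [MeasurableSpace γ] (hUV : IndepFun U V P)
    (hU : Measurable U) (hV : Measurable V) {F : α × β → ℝ} (hF : Measurable F)
    (hi : Integrable (fun ω => F (U ω, V ω)) P) {p : α → γ} (hp : Measurable p) {g : γ → ℝ}
    (hg : Measurable g) (hgX : Integrable (fun ω => g (p (U ω))) P)
    (hle : ∀ u, g (p u) ≤ ∫ ω, F (u, V ω) ∂P) :
    ∀ᵐ ω ∂P, g (p (U ω)) ≤ (P[fun ω' => F (U ω', V ω') |
      MeasurableSpace.comap (fun ω => p (U ω)) inferInstance]) ω := by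
  refine ae_le_condExp_comap (hp.comp hU) hi hg hgX fun A hA => ?_
  have hB : MeasurableSet (p ⁻¹' A) := hp hA
  have hB' : MeasurableSet ((fun ω => p (U ω)) ⁻¹' A) := (hp.comp hU) hA
  have hB2 : MeasurableSet (Prod.fst ⁻¹' (p ⁻¹' A) : Set (α × β)) := measurable_fst hB
  rw [← integral_indicator hB', ← integral_indicator hB']
  have e : ((fun ω => p (U ω)) ⁻¹' A).indicator (fun ω => F (U ω, V ω)) =
      fun ω => ((Prod.fst ⁻¹' (p ⁻¹' A)).indicator F) (U ω, V ω) := by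
    ext ω; by_cases hω : p (U ω) ∈ A <;> simp [Set.indicator, hω]
  have hFi : Integrable (fun ω => ((Prod.fst ⁻¹' (p ⁻¹' A)).indicator F) (U ω, V ω)) P := by
    rw [← e]; exact hi.indicator hB'
  rw [e, integral_eq_integral_integral_of_indepFun hUV hU hV (hF.indicator hB2) hFi]
  refine integral_mono (hgX.indicator hB')
    (integrable_integral_of_indepFun hUV hU hV (hF.indicator hB2) hFi) fun ω => ?_
  by_cases hω : p (U ω) ∈ A
  · simpa [Set.indicator, hω] using hle (U ω)
  · simp [Set.indicator, hω]

end Independence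

/-! ### Functions of disjoint families of samples -/

section IID

theorem measurable_iSup_comap {Ω ι Ξ : Type*} [MeasurableSpace Ξ] {ξ : ι → Ω → Ξ} {S : Set ι}
    {i : ι} (hi : i ∈ S) : Measurable[⨆ i ∈ S, MeasurableSpace.comap (ξ i) inferInstance] (ξ i) :=
  (comap_measurable (ξ i)).mono (le_iSup₂_of_le i hi le_rfl) le_rfl

variable {Ω ι Ξ : Type*} [MeasurableSpace Ω] [MeasurableSpace Ξ] {P : Measure Ω} {𝒟 : Measure Ξ}
  {ξ : ι → Ω → Ξ}

theorem IsIID.indepFun {α β : Type*} [MeasurableSpace α] [MeasurableSpace β]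
    {U : Ω → α} {V : Ω → β} (h : IsIID P 𝒟 ξ) {S T : Set ι} (hST : Disjoint S T)
    (hU : Measurable[⨆ i ∈ S, MeasurableSpace.comap (ξ i) inferInstance] U)
    (hV : Measurable[⨆ i ∈ T, MeasurableSpace.comap (ξ i) inferInstance] V) :
    IndepFun U V P := by
  rw [IndepFun_iff_Indep]
  exact indep_of_indep_of_le_left (indep_of_indep_of_le_right
    (indep_iSup_of_disjoint (fun i => (h.measurable i).comap_le) h.indep hST)
    hV.comap_le) hU.comap_le

theorem IsIID.precomp {κ : Type*} (h : IsIID P 𝒟 ξ) {e : κ → ι} (he : Function.Injective e) :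
    IsIID P 𝒟 fun k => ξ (e k) :=
  ⟨fun _ => h.measurable _, fun _ => h.law _, h.indep.precomp he⟩

end IID

theorem integrable_inner_of_memLp {Ω E : Type*} [MeasurableSpace Ω] {P : Measure Ω}
    [NormedAddCommGroup E] [InnerProductSpace ℝ E] {u v : Ω → E} (hu : MemLp u 2 P)
    (hv : MemLp v 2 P) : Integrable (fun ω => ⟪u ω, v ω⟫) P :=
  (hu.norm.integrable_mul hv.norm).mono' (hu.1.inner hv.1)
    (Filter.Eventually.of_forall fun _ => norm_inner_le_norm _ _)

/-! ### Mean and variance of the mini-batch error -/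

section Noise

variable {m n : ℕ} {Ξ : Type*}

/-- The error of the mini-batch stochastic gradient. -/
noncomputable def noise (f : Joint m n → ℝ) (G : Joint m n → Ξ → Joint m n) (M : ℕ)
    (z : Joint m n) (s : Fin M → Ξ) : Joint m n :=
  (M : ℝ)⁻¹ • ∑ i, G z (s i) - gradient f z

theorem gradSum_eq (G : Joint m n → Ξ → Joint m n) (z : Joint m n) (s : ℕ → Ξ) (k : ℕ) :
    gradSum G z s k = (∑ i ∈ Finset.range k, G z (s i), k) := by
  induction k with
  | zero => simp [gradSum]
  | succ k ih => simp [gradSum, ih, Finset.sum_range_succ]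

theorem miniBatch_fst (f : Joint m n → ℝ) (G : Joint m n → Ξ → Joint m n) (M : ℕ)
    (z : Joint m n) (s : ℕ → Ξ) :
    (miniBatch G M z s).1 = gradient f z + noise f G M z fun i => s i := by
  simp [miniBatch, gradSum_eq, noise, Finset.sum_range]

@[simp] theorem miniBatch_snd (G : Joint m n → Ξ → Joint m n) (M : ℕ)
    (z : Joint m n) (s : ℕ → Ξ) : (miniBatch G M z s).2 = M := by
  simp [miniBatch, gradSum_eq]

theorem noise_eq_smul_sum {f : Joint m n → ℝ} {G : Joint m n → Ξ → Joint m n} {M : ℕ} (hM : 0 < M)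
    (z : Joint m n) (s : Fin M → Ξ) :
    noise f G M z s = (M : ℝ)⁻¹ • ∑ i, (G z (s i) - gradient f z) := by
  have : (M : ℝ) ≠ 0 := by positivity
  rw [noise, Finset.sum_sub_distrib, Finset.sum_const, Finset.card_univ, Fintype.card_fin,
    smul_sub, ← Nat.cast_smul_eq_nsmul ℝ, smul_smul, inv_mul_cancel₀ this, one_smul]

variable [MeasurableSpace Ξ]

theorem measurable_miniBatch {α : Type*} {mα : MeasurableSpace α} {G : Joint m n → Ξ → Joint m n}
    (hG : Measurable (Function.uncurry G)) {M : ℕ} {z : α → Joint m n} (hz : Measurable z)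
    {s : α → ℕ → Ξ} (hs : ∀ i < M, Measurable fun a => s a i) :
    Measurable fun a => (miniBatch G M (z a) (s a)).1 := by
  simp only [miniBatch, gradSum_eq]
  refine Measurable.fun_const_smul (Finset.measurable_fun_sum _ fun i hi => ?_) _
  exact hG.comp (hz.prodMk (hs i (Finset.mem_range.1 hi)))

theorem measurable_noise {α : Type*} [MeasurableSpace α] {ℓ : ℝ} {f : Joint m n → ℝ}
    {G : Joint m n → Ξ → Joint m n} (hf : IsSmooth ℓ f) (hG : Measurable (Function.uncurry G))
    {M : ℕ} {z : α → Joint m n} (hz : Measurable z) {s : α → Fin M → Ξ} (hs : Measurable s) :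
    Measurable fun a => noise f G M (z a) (s a) := by
  unfold noise
  refine Measurable.sub (Measurable.fun_const_smul (Finset.measurable_fun_sum _ fun i _ => ?_) _)
    (hf.continuous_gradient.measurable.comp hz)
  exact hG.comp (hz.prodMk ((measurable_pi_apply i).comp hs))

variable {Ω : Type*} [MeasurableSpace Ω] {P : Measure Ω} [IsProbabilityMeasure P]
  {𝒟 : Measure Ξ} [IsProbabilityMeasure 𝒟]
  {σ ℓ : ℝ} {f : Joint m n → ℝ} {G : Joint m n → Ξ → Joint m n}

/-- At a fixed point the M errors are independent and centred, so the cross terms vanish and at most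
M · σ²/M² remains. -/
theorem memLp_noise_const (hG : IsStochOracle 𝒟 σ f G) {M : ℕ} (hM : 0 < M)
    {ξ : Fin M → Ω → Ξ} (hξ : IsIID P 𝒟 ξ) (z : Joint m n) :
    MemLp (fun ω => noise f G M z fun i => ξ i ω) 2 P ∧
      ∫ ω, noise f G M z (fun i => ξ i ω) ∂P = 0 ∧
      ∫ ω, ‖noise f G M z fun i => ξ i ω‖ ^ 2 ∂P ≤ σ ^ 2 / M := by
  set g : Ξ → Joint m n := fun s => G z s - gradient f z with hg
  have hgm : Measurable g := (hG.measurable.comp measurable_prodMk_left).sub_const _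
  have hg2 : MemLp g 2 𝒟 := (hG.memLp z).sub (memLp_const _)
  have hw2 : ∀ i, MemLp (fun ω => g (ξ i ω)) 2 P := fun i => by
    rw [← hξ.law i] at hg2
    exact hg2.comp_of_map (hξ.measurable i).aemeasurable
  have hw0 : ∀ i, ∫ ω, g (ξ i ω) ∂P = 0 := fun i => by
    rw [← integral_map (hξ.measurable i).aemeasurable hgm.aestronglyMeasurable, hξ.law i]
    exact hG.unbiased z
  have hwv : ∀ i, ∫ ω, ‖g (ξ i ω)‖ ^ 2 ∂P ≤ σ ^ 2 := fun i => by
    rw [← integral_map (f := fun s => ‖g s‖ ^ 2) (hξ.measurable i).aemeasurable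
      (hgm.norm.pow_const 2).aestronglyMeasurable, hξ.law i]
    exact hG.variance z
  have hwi : ∀ i, Integrable (fun ω => g (ξ i ω)) P := fun i => (hw2 i).integrable one_le_two
  have hii : ∀ i j, Integrable (fun ω => ⟪g (ξ i ω), g (ξ j ω)⟫) P := fun i j =>
    integrable_inner_of_memLp (hw2 i) (hw2 j)
  have hin : ∀ i j, ∫ ω, ⟪g (ξ i ω), g (ξ j ω)⟫ ∂P =
      if i = j then ∫ ω, ‖g (ξ i ω)‖ ^ 2 ∂P else 0 := fun i j => by
    split_ifs with hij
    · subst hij; simp only [real_inner_self_eq_norm_sq]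
    · have hind : IndepFun (fun ω => g (ξ i ω)) (fun ω => g (ξ j ω)) P :=
        (hξ.indep.indepFun hij).comp hgm hgm
      have := hind.integral_bilin (hwi i) (hwi j) (innerSL ℝ)
      rw [hw0, map_zero] at this
      exact this
  have hM' : (0 : ℝ) < M := by exact_mod_cast hM
  simp only [noise_eq_smul_sum hM]
  refine ⟨(memLp_finsetSum _ fun i _ => hw2 i).const_smul (M : ℝ)⁻¹, ?_, ?_⟩
  · rw [integral_smul, integral_finsetSum _ fun i _ => hwi i]
    simp [hw0]
  · have e : ∀ ω, ‖(M : ℝ)⁻¹ • ∑ i, (G z (ξ i ω) - gradient f z)‖ ^ 2 =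
        ((M : ℝ)⁻¹) ^ 2 * ∑ i, ∑ j, ⟪g (ξ i ω), g (ξ j ω)⟫ := fun ω => by
      rw [norm_smul, mul_pow, ← real_inner_self_eq_norm_sq (∑ i, _), sum_inner]
      simp only [inner_sum]
      simp [hg]
    simp only [e]
    rw [integral_const_mul, integral_finsetSum _ fun i _ =>
      integrable_finsetSum _ fun j _ => hii i j]
    simp only [integral_finsetSum Finset.univ fun j _ => hii _ j, hin, Finset.sum_ite_eq,
      Finset.mem_univ, if_true]
    calc _ ≤ ((M : ℝ)⁻¹) ^ 2 * ∑ i : Fin M, σ ^ 2 := by gcongr with i; exact hwv i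
      _ = σ ^ 2 / M := by
        rw [Finset.sum_const, Finset.card_univ, Fintype.card_fin, nsmul_eq_mul]
        field_simp

theorem memLp_noise (hf : IsSmooth ℓ f) (hG : IsStochOracle 𝒟 σ f G) {M : ℕ} (hM : 0 < M)
    {ξ : Fin M → Ω → Ξ} (hξ : IsIID P 𝒟 ξ) {Z : Ω → Joint m n} (hZ : Measurable Z)
    (hind : IndepFun Z (fun ω i => ξ i ω) P) :
    MemLp (fun ω => noise f G M (Z ω) fun i => ξ i ω) 2 P ∧
      ∫ ω, ‖noise f G M (Z ω) fun i => ξ i ω‖ ^ 2 ∂P ≤ σ ^ 2 / M := by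
  have hn := measurable_noise hf hG.measurable (measurable_fst (α := Joint m n) (β := Fin M → Ξ))
    measurable_snd
  have hξm : Measurable fun ω i => ξ i ω := measurable_pi_lambda _ fun i => hξ.measurable i
  have hm : Measurable fun ω => noise f G M (Z ω) fun i => ξ i ω :=
    measurable_noise hf hG.measurable hZ hξm
  obtain ⟨h1, h2⟩ := integrable_and_integral_le_of_indepFun hind hZ hξm
    (F := fun p => ‖noise f G M p.1 p.2‖ ^ 2) (hn.norm.pow_const 2) (fun _ => sq_nonneg _)
    (fun z => (memLp_two_iff_integrable_sq_norm (memLp_noise_const hG hM hξ z).1.1).1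
      (memLp_noise_const hG hM hξ z).1)
    (fun z => (memLp_noise_const hG hM hξ z).2.2)
  exact ⟨(memLp_two_iff_integrable_sq_norm hm.aestronglyMeasurable).2 h1, h2⟩

theorem integral_inner_noise (hf : IsSmooth ℓ f) (hG : IsStochOracle 𝒟 σ f G) {M : ℕ}
    (hM : 0 < M) {ξ : Fin M → Ω → Ξ} (hξ : IsIID P 𝒟 ξ) {Z : Ω → Joint m n} (hZ : Measurable Z)
    (hind : IndepFun Z (fun ω i => ξ i ω) P) {c : Joint m n → Joint m n} (hc : Measurable c)
    (hc2 : MemLp (fun ω => c (Z ω)) 2 P) :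
    ∫ ω, ⟪c (Z ω), noise f G M (Z ω) fun i => ξ i ω⟫ ∂P = 0 := by
  have hn := measurable_noise hf hG.measurable (measurable_fst (α := Joint m n) (β := Fin M → Ξ))
    measurable_snd
  have hξm : Measurable fun ω i => ξ i ω := measurable_pi_lambda _ fun i => hξ.measurable i
  rw [integral_eq_integral_integral_of_indepFun hind hZ hξm
    (F := fun p => ⟪c p.1, noise f G M p.1 p.2⟫) ((hc.comp measurable_fst).inner hn)
    (integrable_inner_of_memLp hc2 (memLp_noise hf hG hM hξ hZ hind).1)]
  have : ∀ ω, ∫ ω', ⟪c (Z ω), noise f G M (Z ω) fun i => ξ i ω'⟫ ∂P = 0 := fun ω => by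
    have h := memLp_noise_const hG hM hξ (Z ω)
    rw [integral_inner (h.1.integrable one_le_two), h.2.1, inner_zero_right]
  simp [this]

end Noise

/-! ### Projected stochastic gradient ascent -/

section Sga

variable {m n : ℕ} {Ξ : Type*} {ℓ μ : ℝ} {f : Joint m n → ℝ} {Y : Set (Vec n)}
  {G : Joint m n → Ξ → Joint m n}

theorem sga_calls (G : Joint m n → Ξ → Joint m n) (Y : Set (Vec n)) (η : ℝ) (B : ℕ) (x : Vec m)
    (y₀ : Vec n) (s : ℕ → ℕ → Ξ) (N : ℕ) : (sga G Y η B x y₀ s N).2 = N * B := by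
  induction N with
  | zero => simp [sga]
  | succ N ih => simp [sga, ih, Nat.succ_mul]

theorem sga_mem (h : IsNSC ℓ μ f Y) (η : ℝ) (B : ℕ) (x : Vec m)
    {y₀ : Vec n} (hy : y₀ ∈ Y) (s : ℕ → ℕ → Ξ) (N : ℕ) : (sga G Y η B x y₀ s N).1 ∈ Y := by
  cases N with
  | zero => exact hy
  | succ N => exact h.proj_mem _

/-- The σ-algebra on `α` is a free parameter and only samples that are actually read are
constrained. Applied to a σ-algebra generated by some of the samples, this says which samples the
iterate depends on. -/
theorem measurable_sga [MeasurableSpace Ξ] {α : Type*} {mα : MeasurableSpace α}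
    (h : IsNSC ℓ μ f Y) (hG : Measurable (Function.uncurry G)) (η : ℝ) {B N : ℕ}
    {x : α → Vec m} (hx : Measurable x) {y₀ : α → Vec n} (hy : Measurable y₀)
    {s : α → ℕ → ℕ → Ξ} (hs : ∀ j < N, ∀ i < B, Measurable fun a => s a j i) :
    Measurable fun a => (sga G Y η B (x a) (y₀ a) (s a) N).1 := by
  induction N with
  | zero => exact hy
  | succ N ih =>
    have hr := ih fun j hj => hs j (hj.trans N.lt_succ_self)
    have hb := measurable_miniBatch hG (measurable_pt hx hr) (hs N N.lt_succ_self)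
    exact h.continuous_proj.measurable.comp
      (hr.add ((measurable_yPart.comp hb).const_smul η))

theorem IsNSC.memLp_comp {Ω E : Type*} [MeasurableSpace Ω] {P : Measure Ω} [IsFiniteMeasure P]
    [NormedAddCommGroup E] (h : IsNSC ℓ μ f Y) {φ : Vec n → E} (hφ : Continuous φ)
    {y : Ω → Vec n} (hy : Measurable y) (hyY : ∀ ω, y ω ∈ Y) (p : ENNReal) :
    MemLp (fun ω => φ (y ω)) p P := by
  obtain ⟨C, hC⟩ := h.isCompact.exists_bound_of_continuousOn hφ.continuousOn
  exact MemLp.of_bound (hφ.comp_aestronglyMeasurable hy.aestronglyMeasurable) C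
    (Filter.Eventually.of_forall fun ω => hC _ (hyY ω))

theorem IsNSC.continuous_right (h : IsNSC ℓ μ f Y) (x : Vec m) :
    Continuous fun y => f (pt x y) := h.continuous.comp (by fun_prop)

theorem integral_sga_succ_le [MeasurableSpace Ξ] {Ω : Type*} [MeasurableSpace Ω] {P : Measure Ω}
    [IsProbabilityMeasure P] {𝒟 : Measure Ξ} [IsProbabilityMeasure 𝒟] {σ : ℝ}
    (h : IsNSC ℓ μ f Y) (hn : 0 < n) (hG : IsStochOracle 𝒟 σ f G) {B : ℕ} (hB : 0 < B)
    (x : Vec m) {y₀ : Vec n} (hy : y₀ ∈ Y) {ξ : ℕ → ℕ → Ω → Ξ}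
    (hξ : IsIID P 𝒟 (fun a : ℕ × ℕ => ξ a.1 a.2)) (N : ℕ) :
    Phi f Y x - ∫ ω, f (pt x (sga G Y (1 / ℓ) B x y₀ (fun j i => ξ j i ω) (N + 1)).1) ∂P +
      ℓ / 2 * ∫ ω, ‖(sga G Y (1 / ℓ) B x y₀ (fun j i => ξ j i ω) (N + 1)).1 -
        yStar f Y x‖ ^ 2 ∂P ≤
    (ℓ - μ) / 2 * ∫ ω, ‖(sga G Y (1 / ℓ) B x y₀ (fun j i => ξ j i ω) N).1 -
        yStar f Y x‖ ^ 2 ∂P + 1 / ℓ * (σ ^ 2 / B) := by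
  have hℓ := h.mu_pos.trans_le (h.mu_le hn)
  set u := yStar f Y x with hu
  set y : ℕ → Ω → Vec n := fun k ω => (sga G Y (1 / ℓ) B x y₀ (fun j i => ξ j i ω) k).1 with hydef
  have hyY : ∀ k ω, y k ω ∈ Y := fun k ω => sga_mem h _ _ _ hy _ _
  have hym : ∀ k, Measurable (y k) := fun k =>
    measurable_sga h hG.measurable _ measurable_const measurable_const
      fun j _ i _ => hξ.measurable (j, i)
  have hξN : IsIID P 𝒟 (fun i : Fin B => ξ N i) :=
    hξ.precomp (e := fun i : Fin B => (N, (i : ℕ))) fun i j hij => by simpa [Fin.ext_iff] using hij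
  set Z : Ω → Joint m n := fun ω => pt x (y N ω) with hZdef
  have hZ : Measurable Z := measurable_pt measurable_const (hym N)
  have hind : IndepFun Z (fun ω (i : Fin B) => ξ N i ω) P := by
    have hd : Disjoint {a : ℕ × ℕ | a.1 < N} {a : ℕ × ℕ | a.1 = N} :=
      Set.disjoint_left.2 fun a h1 h2 => (ne_of_lt h1) h2
    refine hξ.indepFun hd ?_ ?_
    · refine measurable_pt measurable_const ?_
      exact measurable_sga h hG.measurable _ measurable_const measurable_const
        fun j hj i _ => measurable_iSup_comap (ξ := fun a : ℕ × ℕ => ξ a.1 a.2)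
          (i := (j, i)) (S := {a : ℕ × ℕ | a.1 < N}) hj
    · exact @measurable_pi_lambda _ _ _ (_) _ _ fun i =>
        measurable_iSup_comap (ξ := fun a : ℕ × ℕ => ξ a.1 a.2)
          (i := (N, (i : ℕ))) (S := {a : ℕ × ℕ | a.1 = N}) rfl
  set w : Ω → Joint m n := fun ω => noise f G B (Z ω) fun i => ξ N i ω with hw
  obtain ⟨hw2, hwv⟩ := memLp_noise h.smooth hG hB hξN hZ hind
  -- Padding with a zero `x`-part makes the linear error term an inner product with the full noise
  -- vector.
  set c : Joint m n → Joint m n := fun z =>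
    pt 0 (proj Y (yPart z + (1 / ℓ) • yPart (gradient f z)) - u) with hc
  have hgc := h.smooth.continuous_gradient
  have hcc : Continuous c := by
    have := h.continuous_proj
    fun_prop
  have hc2 : MemLp (fun ω => c (Z ω)) 2 P :=
    h.memLp_comp (φ := fun y => c (pt x y)) (hcc.comp (by fun_prop)) (hym N) (hyY N) 2
  have h0 := integral_inner_noise h.smooth hG hB hξN hZ hind hcc.measurable hc2
  have hpt : ∀ ω, Phi f Y x - f (pt x (y (N + 1) ω)) + ℓ / 2 * ‖y (N + 1) ω - u‖ ^ 2 ≤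
      (ℓ - μ) / 2 * ‖y N ω - u‖ ^ 2 + ⟪c (Z ω), w ω⟫ + 1 / ℓ * ‖w ω‖ ^ 2 := fun ω => by
    have e : y (N + 1) ω = proj Y (y N ω + (1 / ℓ) • (yPart (gradient f (pt x (y N ω))) +
        yPart (w ω))) := by
      rw [← yPart_add]
      simp only [hydef, sga, miniBatch_fst f]
      rfl
    have a := h.ascent_step hn x (y N ω) (yPart (w ω))
    rw [← e] at a
    have i1 : ⟪c (Z ω), w ω⟫ =
        ⟪proj Y (y N ω + (1 / ℓ) • yPart (gradient f (pt x (y N ω)))) - u, yPart (w ω)⟫ := by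
      rw [inner_eq_parts]
      simp [hc, hZdef]
    have i2 : 1 / ℓ * ‖yPart (w ω)‖ ^ 2 ≤ 1 / ℓ * ‖w ω‖ ^ 2 := by
      gcongr; exact norm_yPart_le _
    rw [i1]
    linarith
  have I1 : ∀ k, Integrable (fun ω => f (pt x (y k ω))) P := fun k =>
    (h.memLp_comp (h.continuous_right x) (hym k) (hyY k) 1).integrable le_rfl
  have I2 : ∀ k, Integrable (fun ω => ‖y k ω - u‖ ^ 2) P := fun k =>
    (h.memLp_comp (φ := fun y => ‖y - u‖ ^ 2) (by fun_prop) (hym k) (hyY k) 1).integrable le_rfl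
  have I3 : Integrable (fun ω => ⟪c (Z ω), w ω⟫) P := integrable_inner_of_memLp hc2 hw2
  have I4 : Integrable (fun ω => ‖w ω‖ ^ 2) P :=
    (memLp_two_iff_integrable_sq_norm hw2.1).1 hw2
  have J1 : Integrable (fun ω => Phi f Y x - f (pt x (y (N + 1) ω))) P :=
    (integrable_const _).sub (I1 _)
  have J2 : Integrable (fun ω => (ℓ - μ) / 2 * ‖y N ω - u‖ ^ 2 + ⟪c (Z ω), w ω⟫) P :=
    ((I2 N).const_mul _).add I3
  have key := integral_mono (J1.add ((I2 (N + 1)).const_mul (ℓ / 2)))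
    (J2.add (I4.const_mul (1 / ℓ))) hpt
  simp only [Pi.add_apply] at key
  rw [integral_add J1 ((I2 (N + 1)).const_mul _), integral_sub (integrable_const _) (I1 _),
    integral_const_mul, integral_add J2 (I4.const_mul _), integral_add ((I2 N).const_mul _) I3,
    integral_const_mul, integral_const_mul, h0] at key
  simp only [integral_const, probReal_univ, smul_eq_mul, one_mul, add_zero] at key
  have : 1 / ℓ * ∫ ω, ‖w ω‖ ^ 2 ∂P ≤ 1 / ℓ * (σ ^ 2 / B) := by gcongr
  linarith

/-- The contraction behind the linear convergence of projected stochastic gradient ascent: `a` are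
the mean squared distances to the maximizer and `g` the mean optimality gaps. -/
theorem ascent_recursion {ℓ μ z D : ℝ} (hμ : 0 < μ) (hμℓ : μ ≤ ℓ) (hz : 0 < z) {a g : ℕ → ℝ}
    (ha0 : ∀ j, 0 ≤ a j)
    (ha : a 0 ≤ D ^ 2) (hg : ∀ j, μ / 2 * a j ≤ g j)
    (hs : ∀ j, g (j + 1) + ℓ / 2 * a (j + 1) ≤ (ℓ - μ) / 2 * a j + z / (2 * (ℓ / μ))) {N : ℕ}
    (hN : 32 * (ℓ / μ * max 1 (Real.log (ℓ * D ^ 2 / z))) ≤ N) :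
    g N ≤ z ∧ a N ≤ z / ℓ := by
  have hℓ := hμ.trans_le hμℓ
  set κ := ℓ / μ with hκ
  have hκ1 : 1 ≤ κ := (one_le_div hμ).2 hμℓ
  have hκ0 : 0 < κ := by positivity
  have hμe : μ = ℓ / κ := by rw [hκ]; field_simp
  set q := 1 - 1 / κ with hq
  have hq0 : 0 ≤ q := sub_nonneg.2 ((div_le_one hκ0).2 hκ1)
  have hq1 : q ≤ 1 := by rw [hq]; linarith [one_div_pos.2 hκ0]
  set b : ℕ → ℝ := fun j => ℓ / 2 * a j with hb
  set E := ℓ / 2 * D ^ 2 with hE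
  have hE0 : 0 ≤ E := by positivity
  have e1 : ∀ j, (ℓ - μ) / 2 * a j = q * b j := fun j => by rw [hμe, hq, hb]; field_simp
  have e2 : ∀ j, μ / 2 * a j = 1 / κ * b j := fun j => by rw [hμe, hb]; field_simp
  have hs' : ∀ j, g (j + 1) + b (j + 1) ≤ q * b j + z / (2 * κ) := fun j => e1 j ▸ hs j
  have hg' : ∀ j, 1 / κ * b j ≤ g j := fun j => e2 j ▸ hg j
  have hk : z / (2 * κ) = z / 2 * (1 / κ) := by field_simp
  -- By quadratic growth the gap on the left of `hs'` contributes b/κ. The recursion (1 + 1/κ)b ↦ qb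
  -- + z/(2κ) then has the fixed point z/4.
  have hbj : ∀ j, b j ≤ z / 4 + q ^ j * E := by
    intro j
    induction j with
    | zero =>
      have : b 0 ≤ E := mul_le_mul_of_nonneg_left ha (by positivity)
      simp only [pow_zero, one_mul]; linarith
    | succ j ih =>
      have p : 0 < 1 / κ := by positivity
      have h1 : (1 + 1 / κ) * b (j + 1) ≤ q * (z / 4 + q ^ j * E) + z / 2 * (1 / κ) := by
        have := hs' j
        have := hg' (j + 1)
        have := mul_le_mul_of_nonneg_left ih hq0
        linarith
      have h2 : 0 ≤ q ^ (j + 1) * E * (1 / κ) := by positivity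
      have h3 : q * (z / 4 + q ^ j * E) + z / 2 * (1 / κ) ≤
          (1 + 1 / κ) * (z / 4 + q ^ (j + 1) * E) := by
        have : q * (z / 4) = z / 4 - z / 4 * (1 / κ) := by rw [hq]; ring
        rw [pow_succ] at h2 ⊢
        linarith
      exact le_of_mul_le_mul_left (h1.trans h3) (by positivity)
  set L := max 1 (Real.log (ℓ * D ^ 2 / z)) with hL
  have hL1 : 1 ≤ L := le_max_left _ _
  have hκL : 1 ≤ κ * L := by nlinarith
  -- The first `k` steps shrink the distance; the last one is kept to bound the gap. Squared
  -- distance alone would not do, as the gradient at y⋆ need not vanish.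
  obtain ⟨k, rfl⟩ : ∃ k, N = k + 1 := by
    cases N with
    | zero => norm_num at hN; linarith
    | succ k => exact ⟨k, rfl⟩
  have hkN : κ * (L + 1) ≤ k := by
    push_cast at hN
    nlinarith
  have hexp : q ^ k ≤ Real.exp (-(L + 1)) := by
    calc q ^ k ≤ Real.exp (-(1 / κ)) ^ k := by
          gcongr
          have := Real.add_one_le_exp (-(1 / κ))
          rw [hq]; linarith
      _ = Real.exp (-(k / κ)) := by rw [← Real.exp_nat_mul]; congr 1; ring
      _ ≤ _ := by
          gcongr
          rw [le_div_iff₀ hκ0]; linarith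
  have hEL : E ≤ z / 2 * Real.exp L := by
    -- For D = 0 the logarithm has its default value 0 and carries no information, but then E = 0.
    rcases hE0.eq_or_lt with h0 | h0
    · rw [← h0]; positivity
    · have hpos : 0 < ℓ * D ^ 2 / z := by
        have : 0 < ℓ * D ^ 2 := by linarith
        positivity
      have : ℓ * D ^ 2 / z ≤ Real.exp L := by
        rw [← Real.log_le_iff_le_exp hpos]; exact le_max_right _ _
      rw [div_le_iff₀ hz] at this
      linarith
  have he : q ^ k * E ≤ z / 4 := by
    have h2 : (2 : ℝ) ≤ Real.exp 1 := by have := Real.add_one_le_exp (1 : ℝ); linarith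
    have h3 : Real.exp (-1) ≤ 1 / 2 := by
      rw [Real.exp_neg, inv_eq_one_div]; gcongr
    calc q ^ k * E ≤ Real.exp (-(L + 1)) * (z / 2 * Real.exp L) := by gcongr
      _ = z / 2 * Real.exp (-1) := by
        rw [mul_left_comm, ← Real.exp_add]; congr 2; ring
      _ ≤ z / 2 * (1 / 2) := by gcongr
      _ = z / 4 := by ring
  have hbk := hbj k
  have hbk1 := hbj (k + 1)
  constructor
  · have hbp : 0 ≤ 1 / κ := by positivity
    have h1 := hs' k
    have h2 := hg' (k + 1)
    have h3 := mul_le_mul_of_nonneg_left (hbk.trans (add_le_add_right he (z / 4))) hq0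
    have h4 : 0 ≤ b (k + 1) := mul_nonneg (by positivity) (ha0 _)
    have : q * (z / 4 + z / 4) = z / 2 - z / 2 * (1 / κ) := by rw [hq]; ring
    linarith
  · have h1 : q ^ (k + 1) * E ≤ z / 4 := by
      rw [pow_succ]
      have : 0 ≤ q ^ k * E := by positivity
      nlinarith
    rw [le_div_iff₀ hℓ]
    have : ℓ / 2 * a (k + 1) ≤ z / 4 + q ^ (k + 1) * E := hbk1
    linarith

theorem sga_accuracy [MeasurableSpace Ξ] {Ω : Type*} [MeasurableSpace Ω] {P : Measure Ω}
    [IsProbabilityMeasure P] {𝒟 : Measure Ξ} [IsProbabilityMeasure 𝒟] {σ : ℝ}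
    (h : IsNSC ℓ μ f Y) (hn : 0 < n) (hG : IsStochOracle 𝒟 σ f G) {z : ℝ} (hz : 0 < z) {B : ℕ}
    (hB : max (1 : ℝ) (2 * σ ^ 2 * (ℓ / μ) / (ℓ * z)) ≤ B)
    (x : Vec m) {y₀ : Vec n} (hy : y₀ ∈ Y) {ξ : ℕ → ℕ → Ω → Ξ}
    (hξ : IsIID P 𝒟 (fun a : ℕ × ℕ => ξ a.1 a.2)) {N : ℕ}
    (hN : 32 * (ℓ / μ * max 1 (Real.log (ℓ * Metric.diam Y ^ 2 / z))) ≤ N) :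
    Phi f Y x - z ≤ ∫ ω, f (pt x (sga G Y (1 / ℓ) B x y₀ (fun j i => ξ j i ω) N).1) ∂P ∧
      ∫ ω, ‖(sga G Y (1 / ℓ) B x y₀ (fun j i => ξ j i ω) N).1 - yStar f Y x‖ ^ 2 ∂P ≤ z / ℓ := by
  have hμ := h.mu_pos
  have hℓ := hμ.trans_le (h.mu_le hn)
  have hB1 : (1 : ℝ) ≤ B := (le_max_left _ _).trans hB
  have hB0 : 0 < B := by exact_mod_cast hB1
  have hBσ : 1 / ℓ * (σ ^ 2 / B) ≤ z / (2 * (ℓ / μ)) := by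
    have := (le_max_right _ _).trans hB
    rw [div_le_iff₀ (by positivity)] at this
    rw [div_mul_div_comm, div_le_div_iff₀ (by positivity) (by positivity)]
    linarith
  have hym : ∀ k, Measurable fun ω => (sga G Y (1 / ℓ) B x y₀ (fun j i => ξ j i ω) k).1 :=
    fun k => measurable_sga h hG.measurable _ measurable_const measurable_const
      fun j _ i _ => hξ.measurable (j, i)
  have hyY : ∀ k ω, (sga G Y (1 / ℓ) B x y₀ (fun j i => ξ j i ω) k).1 ∈ Y :=
    fun k ω => sga_mem h _ _ _ hy _ _
  have I1 : ∀ k, Integrable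
      (fun ω => f (pt x (sga G Y (1 / ℓ) B x y₀ (fun j i => ξ j i ω) k).1)) P := fun k =>
    (h.memLp_comp (h.continuous_right x) (hym k) (hyY k) 1).integrable le_rfl
  have I2 : ∀ k, Integrable (fun ω =>
      ‖(sga G Y (1 / ℓ) B x y₀ (fun j i => ξ j i ω) k).1 - yStar f Y x‖ ^ 2) P := fun k =>
    (h.memLp_comp (φ := fun y => ‖y - yStar f Y x‖ ^ 2) (by fun_prop)
      (hym k) (hyY k) 1).integrable le_rfl
  have key := ascent_recursion (D := Metric.diam Y) hμ (h.mu_le hn) hz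
    (a := fun k => ∫ ω, ‖(sga G Y (1 / ℓ) B x y₀ (fun j i => ξ j i ω) k).1 -
      yStar f Y x‖ ^ 2 ∂P)
    (g := fun k => Phi f Y x -
      ∫ ω, f (pt x (sga G Y (1 / ℓ) B x y₀ (fun j i => ξ j i ω) k).1) ∂P)
    (fun j => integral_nonneg fun _ => sq_nonneg _) ?_ ?_ ?_ hN
  · exact ⟨by linarith [key.1], key.2⟩
  · simp only [sga, integral_const, probReal_univ, smul_eq_mul, one_mul]
    rw [← dist_eq_norm]
    gcongr
    exact Metric.dist_le_diam_of_mem h.bounded hy (h.yStar_mem x)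
  · intro k
    have := integral_mono ((I2 k).const_mul (μ / 2)) ((integrable_const (Phi f Y x)).sub (I1 k))
      fun ω => h.quadratic_growth x (hyY k ω)
    rw [integral_const_mul, integral_sub' (integrable_const _) (I1 k)] at this
    simpa using this
  · intro k
    exact (integral_sga_succ_le h hn hG hB0 x hy hξ k).trans (by gcongr)

end Sga

/-! ### Square integrability of assembled vectors -/

section MemLp

variable {m n : ℕ} {Ω : Type*} [MeasurableSpace Ω] {P : Measure Ω}

theorem norm_pt_le (x : Vec m) (y : Vec n) : ‖pt x y‖ ≤ ‖x‖ + ‖y‖ := by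
  refine abs_le_of_sq_le_sq' ?_ (by positivity) |>.2
  rw [norm_sq_eq_parts, xPart_pt, yPart_pt]
  nlinarith [mul_nonneg (norm_nonneg x) (norm_nonneg y)]

theorem memLp_pt {X : Ω → Vec m} {V : Ω → Vec n} {p : ENNReal} (hX : MemLp X p P)
    (hV : MemLp V p P) : MemLp (fun ω => pt (X ω) (V ω)) p P := by
  refine (hX.norm.add hV.norm).mono ?_ (Filter.Eventually.of_forall fun ω => ?_)
  · exact (continuous_pt continuous_fst continuous_snd).comp_aestronglyMeasurable
      (hX.1.prodMk hV.1)
  · exact (norm_pt_le _ _).trans (le_abs_self _)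

theorem memLp_xPart {Z : Ω → Joint m n} {p : ENNReal} (hZ : MemLp Z p P) :
    MemLp (fun ω => xPart (Z ω)) p P :=
  hZ.mono (continuous_xPart.comp_aestronglyMeasurable hZ.1)
    (Filter.Eventually.of_forall fun _ => norm_xPart_le _)

end MemLp

/-! ### The outer descent and its telescoping -/

section Descent

variable {m n : ℕ} {Ω Ξ : Type*} [MeasurableSpace Ω] [MeasurableSpace Ξ] {P : Measure Ω}
  [IsProbabilityMeasure P] {𝒟 : Measure Ξ} {ℓ μ σ : ℝ} {f : Joint m n → ℝ} {Y : Set (Vec n)}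
  {G : Joint m n → Ξ → Joint m n}

theorem IsRun.integral_dist_le {ηx ζ : ℝ} {M : ℕ} {x₀ : Vec m} {ξ : ℕ → ℕ → Ω → Ξ}
    {x : ℕ → Ω → Vec m} {y : ℕ → Ω → Vec n} (hR : IsRun P 𝒟 f Y G ℓ ηx ζ M x₀ ξ x y) (t : ℕ) :
    ∫ ω, ‖y t ω - yStar f Y (x t ω)‖ ^ 2 ∂P ≤ ζ / ℓ := by
  -- No integrability is needed here: both integrals are 0 by default if the squared distance is not
  -- integrable.
  rw [← integral_condExp (hR.measurable_x t).comap_le]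
  calc _ ≤ ∫ _, ζ / ℓ ∂P :=
        integral_mono_ae integrable_condExp (integrable_const _) (hR.oracle_dist t)
    _ = ζ / ℓ := by simp

theorem IsSmooth.memLp_gradient (h : IsSmooth ℓ f) {Z : Ω → Joint m n} {p : ENNReal}
    (hZ : MemLp Z p P) : MemLp (fun ω => gradient f (Z ω)) p P := by
  refine ((memLp_const ‖gradient f 0‖).add (hZ.norm.const_mul ℓ)).mono
    (h.continuous_gradient.comp_aestronglyMeasurable hZ.1)
    (Filter.Eventually.of_forall fun ω => ?_)
  have h1 := h.lipschitz (Z ω) 0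
  rw [sub_zero] at h1
  have h2 := norm_sub_norm_le (gradient f (Z ω)) (gradient f 0)
  refine le_trans ?_ (le_abs_self _)
  simp only [Pi.add_apply]
  linarith

/-- An ℓ-smooth function grows at most quadratically, so square integrable iterates suffice for
𝔼Φ(x_t) to be meaningful. -/
theorem IsSmooth.integrable_comp (h : IsSmooth ℓ f) {Z : Ω → Joint m n} (hZ : MemLp Z 2 P) :
    Integrable (fun ω => f (Z ω)) P := by
  have h2 : Integrable (fun ω => ‖Z ω‖ ^ 2) P := (memLp_two_iff_integrable_sq_norm hZ.1).1 hZ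
  have h1 : Integrable (fun ω => ⟪gradient f 0, Z ω⟫) P :=
    (hZ.integrable one_le_two).const_inner _
  refine (((integrable_const |f 0|).add h1.norm).add (h2.const_mul (ℓ / 2))).mono'
    (h.differentiable.continuous.comp_aestronglyMeasurable hZ.1)
    (Filter.Eventually.of_forall fun ω => ?_)
  have h3 := abs_sub_inner_gradient_le h.differentiable h.lipschitz 0 (Z ω)
  rw [sub_zero] at h3
  simp only [Pi.add_apply, Real.norm_eq_abs]
  have h4 : f (Z ω) = f 0 + ⟪gradient f 0, Z ω⟫ + (f (Z ω) - f 0 - ⟪gradient f 0, Z ω⟫) := by ring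
  rw [h4]
  exact (abs_add_three _ _ _).trans (by gcongr)

theorem IsNSC.memLp_pt (h : IsNSC ℓ μ f Y) {X : Ω → Vec m} (hX2 : MemLp X 2 P) {V : Ω → Vec n}
    (hV : Measurable V) (hVY : ∀ ω, V ω ∈ Y) : MemLp (fun ω => pt (X ω) (V ω)) 2 P :=
  SGDmax.memLp_pt hX2 (h.memLp_comp (φ := id) continuous_id hV hVY 2)

theorem IsNSC.integrable_Phi (h : IsNSC ℓ μ f Y) {X : Ω → Vec m} (hX : Measurable X)
    (hX2 : MemLp X 2 P) : Integrable (fun ω => Phi f Y (X ω)) P := by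
  simp only [h.Phi_eq]
  exact h.smooth.integrable_comp (h.memLp_pt hX2 (h.continuous_yStar.measurable.comp hX)
    fun ω => h.yStar_mem _)

theorem IsNSC.continuous_gradient_Phi (h : IsNSC ℓ μ f Y) (hn : 0 < n) :
    Continuous (gradient (Phi f Y)) := by
  have := h.smooth.continuous_gradient
  have := h.continuous_yStar
  simp only [funext (h.gradient_Phi hn)]
  fun_prop

theorem IsNSC.memLp_gradient_Phi (h : IsNSC ℓ μ f Y) (hn : 0 < n) {X : Ω → Vec m}
    (hX : Measurable X) (hX2 : MemLp X 2 P) :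
    MemLp (fun ω => gradient (Phi f Y) (X ω)) 2 P := by
  simp only [h.gradient_Phi hn]
  exact memLp_xPart (h.smooth.memLp_gradient
    (h.memLp_pt hX2 (h.continuous_yStar.measurable.comp hX) fun ω => h.yStar_mem _))

variable [IsProbabilityMeasure 𝒟]

theorem memLp_descent_step (h : IsNSC ℓ μ f Y) (hG : IsStochOracle 𝒟 σ f G)
    {M : ℕ} (hM : 0 < M) {ξ : ℕ → Ω → Ξ} (hξ : IsIID P 𝒟 fun i : Fin M => ξ i)
    {X : Ω → Vec m} (hX : Measurable X) (hX2 : MemLp X 2 P) {V : Ω → Vec n} (hV : Measurable V)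
    (hVY : ∀ ω, V ω ∈ Y) (hind : IndepFun (fun ω => (X ω, V ω)) (fun ω (i : Fin M) => ξ i ω) P)
    (η : ℝ) :
    MemLp (fun ω => X ω - η • xPart (miniBatch G M (pt (X ω) (V ω)) fun i => ξ i ω).1) 2 P := by
  have hZ : Measurable fun ω => pt (X ω) (V ω) := measurable_pt hX hV
  have hind' : IndepFun (fun ω => pt (X ω) (V ω)) (fun ω (i : Fin M) => ξ i ω) P :=
    hind.comp (φ := fun p : Vec m × Vec n => pt p.1 p.2)
      (measurable_pt measurable_fst measurable_snd) measurable_id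
  simp only [miniBatch_fst f]
  exact hX2.sub ((memLp_xPart ((h.smooth.memLp_gradient (h.memLp_pt hX2 hV hVY)).add
    (memLp_noise h.smooth hG hM hξ hZ hind').1)).const_smul η)

theorem integral_descent_step_le (h : IsNSC ℓ μ f Y) (hn : 0 < n) (hG : IsStochOracle 𝒟 σ f G)
    {M : ℕ} (hM : 0 < M) {ξ : ℕ → Ω → Ξ} (hξ : IsIID P 𝒟 fun i : Fin M => ξ i)
    {X X' : Ω → Vec m} (hX : Measurable X) (hX2 : MemLp X 2 P) {V : Ω → Vec n} (hV : Measurable V)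
    (hVY : ∀ ω, V ω ∈ Y) (hind : IndepFun (fun ω => (X ω, V ω)) (fun ω (i : Fin M) => ξ i ω) P)
    {η : ℝ} (hη : η = 1 / (8 * (ℓ / μ) * ℓ)) (hXm' : Measurable X') (hX2' : MemLp X' 2 P)
    (hX' : ∀ ω, X' ω = X ω - η • xPart (miniBatch G M (pt (X ω) (V ω)) fun i => ξ i ω).1) :
    ∫ ω, Phi f Y (X' ω) ∂P + η / 2 * ∫ ω, ‖gradient (Phi f Y) (X ω)‖ ^ 2 ∂P ≤
      ∫ ω, Phi f Y (X ω) ∂P + η / 2 * ℓ ^ 2 * ∫ ω, ‖V ω - yStar f Y (X ω)‖ ^ 2 ∂P +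
        3 / 16 * η * (σ ^ 2 / M) := by
  have hμ := h.mu_pos
  have hℓ := hμ.trans_le (h.mu_le hn)
  have hη0 : 0 < η := by rw [hη]; positivity
  -- The step size makes the quadratic term of the expansion a small fraction of the linear one.
  have hηκ : 3 / 2 * (ℓ / μ * ℓ) * η ^ 2 = 3 / 16 * η := by
    rw [hη]; field_simp; norm_num
  set Z : Ω → Joint m n := fun ω => pt (X ω) (V ω) with hZdef
  have hZ : Measurable Z := measurable_pt hX hV
  have hZ2 : MemLp Z 2 P := h.memLp_pt hX2 hV hVY
  have hind' : IndepFun Z (fun ω (i : Fin M) => ξ i ω) P :=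
    hind.comp (φ := fun p : Vec m × Vec n => pt p.1 p.2)
      (measurable_pt measurable_fst measurable_snd) measurable_id
  set w : Ω → Joint m n := fun ω => noise f G M (Z ω) fun i => ξ i ω with hw
  obtain ⟨hw2, hwv⟩ := memLp_noise h.smooth hG hM hξ hZ hind'
  -- Collects all terms linear in the noise: −η∇Φ from the linear term of the expansion and
  -- (3/8)η∇ₓf from the cross term of ‖b + v‖². Both are functions of the point Z.
  set c : Joint m n → Joint m n := fun z =>
    pt ((3 / 8 * η) • xPart (gradient f z) - η • gradient (Phi f Y) (xPart z)) 0 with hc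
  have hcc : Continuous c := by
    have := h.smooth.continuous_gradient
    have := h.continuous_gradient_Phi hn
    fun_prop
  have hc2 : MemLp (fun ω => c (Z ω)) 2 P :=
    SGDmax.memLp_pt (((memLp_xPart (h.smooth.memLp_gradient hZ2)).const_smul (3 / 8 * η)).sub
      ((h.memLp_gradient_Phi hn hX hX2).const_smul η)) (memLp_const 0)
  have h0 := integral_inner_noise h.smooth hG hM hξ hZ hind' hcc.measurable hc2
  have hpt : ∀ ω, Phi f Y (X' ω) + η / 2 * ‖gradient (Phi f Y) (X ω)‖ ^ 2 ≤
      Phi f Y (X ω) + η / 2 * ℓ ^ 2 * ‖V ω - yStar f Y (X ω)‖ ^ 2 + ⟪c (Z ω), w ω⟫ +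
        3 / 16 * η * ‖w ω‖ ^ 2 := fun ω => by
    set a := gradient (Phi f Y) (X ω) with ha
    set b := xPart (gradient f (Z ω)) with hb
    set v := xPart (w ω) with hv
    have e : X' ω - X ω = -(η • (b + v)) := by
      rw [hX' ω, miniBatch_fst f]
      simp only [xPart_add, sub_sub_cancel_left]
      rfl
    have h1 := (abs_le.1 (h.abs_Phi_sub_le hn (X ω) (X' ω))).2
    rw [← h.gradient_Phi hn, ← ha, e, inner_neg_right, inner_smul_right, inner_add_right, norm_neg,
      norm_smul, Real.norm_of_nonneg hη0.le, mul_pow, ← mul_assoc, hηκ, norm_add_sq_real] at h1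
    have h2 : ‖a - b‖ ^ 2 ≤ ℓ ^ 2 * ‖V ω - yStar f Y (X ω)‖ ^ 2 := by
      rw [← mul_pow, ha, h.gradient_Phi hn, norm_sub_rev (V ω)]
      gcongr
      exact h.norm_xPart_gradient_sub_le _ _ _
    have h3 := norm_sub_sq_real a b
    have h4 : ⟪c (Z ω), w ω⟫ = 3 / 8 * η * ⟪b, v⟫ - η * ⟪a, v⟫ := by
      rw [inner_eq_parts]
      simp only [hc, xPart_pt, yPart_pt, inner_zero_left, add_zero, inner_sub_left,
        real_inner_smul_left]
      rfl
    have h5 : ‖v‖ ^ 2 ≤ ‖w ω‖ ^ 2 := by gcongr; exact norm_xPart_le _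
    have h6 := mul_le_mul_of_nonneg_left h2 (by positivity : 0 ≤ η / 2)
    have h7 := mul_le_mul_of_nonneg_left h5 (by positivity : 0 ≤ 3 / 16 * η)
    -- Polarizing −η⟪a, b⟫ yields −(η/2)‖b‖², which outweighs the (3/16)η‖b‖² of the quadratic term;
    -- what is left is dropped.
    have h8 : 0 ≤ η * ‖b‖ ^ 2 := by positivity
    rw [h3] at h6
    rw [h4]
    linarith
  have hyS : Measurable fun ω => yStar f Y (X ω) := h.continuous_yStar.measurable.comp hX
  have hd2 : MemLp (fun ω => V ω - yStar f Y (X ω)) 2 P :=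
    (h.memLp_comp (φ := id) continuous_id hV hVY 2).sub
      (h.memLp_comp (φ := id) continuous_id hyS (fun ω => h.yStar_mem _) 2)
  have hg2 := h.memLp_gradient_Phi hn hX hX2
  have I1 := h.integrable_Phi hX hX2
  have I1' := h.integrable_Phi hXm' hX2'
  have I2 : Integrable (fun ω => ‖gradient (Phi f Y) (X ω)‖ ^ 2) P :=
    (memLp_two_iff_integrable_sq_norm hg2.1).1 hg2
  have I3 : Integrable (fun ω => ‖V ω - yStar f Y (X ω)‖ ^ 2) P :=
    (memLp_two_iff_integrable_sq_norm hd2.1).1 hd2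
  have I4 : Integrable (fun ω => ⟪c (Z ω), w ω⟫) P := integrable_inner_of_memLp hc2 hw2
  have I5 : Integrable (fun ω => ‖w ω‖ ^ 2) P := (memLp_two_iff_integrable_sq_norm hw2.1).1 hw2
  have J1 : Integrable (fun ω => Phi f Y (X ω) +
      η / 2 * ℓ ^ 2 * ‖V ω - yStar f Y (X ω)‖ ^ 2) P := I1.add (I3.const_mul _)
  have J2 : Integrable (fun ω => Phi f Y (X ω) +
      η / 2 * ℓ ^ 2 * ‖V ω - yStar f Y (X ω)‖ ^ 2 + ⟪c (Z ω), w ω⟫) P := J1.add I4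
  have key := integral_mono (I1'.add (I2.const_mul (η / 2))) (J2.add (I5.const_mul (3 / 16 * η)))
    hpt
  simp only [Pi.add_apply] at key
  rw [integral_add I1' (I2.const_mul _), integral_add J2 (I5.const_mul _), integral_add J1 I4,
    integral_add I1 (I3.const_mul _), integral_const_mul, integral_const_mul, integral_const_mul,
    h0] at key
  have : 3 / 16 * η * ∫ ω, ‖w ω‖ ^ 2 ∂P ≤ 3 / 16 * η * (σ ^ 2 / M) := by gcongr
  linarith

theorem IsRun.memLp {ηx ζ : ℝ} {M : ℕ} {x₀ : Vec m} {ξ : ℕ → ℕ → Ω → Ξ} {x : ℕ → Ω → Vec m}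
    {y : ℕ → Ω → Vec n} (hR : IsRun P 𝒟 f Y G ℓ ηx ζ M x₀ ξ x y) (h : IsNSC ℓ μ f Y)
    (hG : IsStochOracle 𝒟 σ f G) (hM : 0 < M) (t : ℕ) : MemLp (x t) 2 P := by
  induction t with
  | zero => simpa only [funext hR.init] using memLp_const x₀
  | succ t ih =>
    rw [funext (hR.step t)]
    exact memLp_descent_step h hG hM (hR.iid t) (hR.measurable_x t) ih (hR.measurable_y t)
      (hR.mem t) (hR.fresh t) ηx

theorem IsRun.returnsStationary {ηx ζ ε : ℝ} {M : ℕ} {x₀ : Vec m} {ξ : ℕ → ℕ → Ω → Ξ}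
    {x : ℕ → Ω → Vec m} {y : ℕ → Ω → Vec n} (hR : IsRun P 𝒟 f Y G ℓ ηx ζ M x₀ ξ x y)
    (h : IsNSC ℓ μ f Y) (hn : 0 < n) (hG : IsStochOracle 𝒟 σ f G) (hε : 0 < ε)
    (hηx : ηx = 1 / (8 * (ℓ / μ) * ℓ)) (hζ : ζ = ε ^ 2 / (6 * ℓ))
    (hM : max (1 : ℝ) (12 * (ℓ / μ) * σ ^ 2 / ε ^ 2) ≤ M) {T : ℕ}
    (hT : 32 * (ℓ / μ * ℓ * gap f Y x₀ / ε ^ 2) ≤ T + 1) :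
    ReturnsStationary P (Phi f Y) ε x T := by
  have hμ := h.mu_pos
  have hℓ := hμ.trans_le (h.mu_le hn)
  have hκ1 : 1 ≤ ℓ / μ := (one_le_div hμ).2 (h.mu_le hn)
  have hη0 : 0 < ηx := by rw [hηx]; positivity
  have hM1 : (1 : ℝ) ≤ M := (le_max_left _ _).trans hM
  have hM0 : 0 < M := by exact_mod_cast hM1
  have hX2 := hR.memLp h hG hM0
  refine ⟨fun x => (h.hasGradientAt_Phi hn x).differentiableAt,
    fun t _ => h.memLp_gradient_Phi hn (hR.measurable_x t) (hX2 t), ?_⟩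
  -- The batch size gives ε²/(12κ); κ ≥ 1 weakens this to ε²/12, and 3/16 · 1/12 is the 1/64 below.
  have hσ : σ ^ 2 / M ≤ ε ^ 2 / 12 := by
    have h1 := (le_max_right _ _).trans hM
    rw [div_le_iff₀ (by positivity)] at h1
    rw [div_le_div_iff₀ (by positivity) (by positivity)]
    nlinarith [sq_nonneg σ]
  have hstep : ∀ t, ηx / 2 * ∫ ω, ‖gradient (Phi f Y) (x t ω)‖ ^ 2 ∂P ≤
      ∫ ω, Phi f Y (x t ω) ∂P - ∫ ω, Phi f Y (x (t + 1) ω) ∂P +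
        ηx * ε ^ 2 * (1 / 12 + 1 / 64) := fun t => by
    have h1 := integral_descent_step_le h hn hG hM0 (hR.iid t) (hR.measurable_x t) (hX2 t)
      (hR.measurable_y t) (hR.mem t) (hR.fresh t) hηx (hR.measurable_x (t + 1)) (hX2 (t + 1))
      (hR.step t)
    have h2 := mul_le_mul_of_nonneg_left (hR.integral_dist_le t)
      (by positivity : 0 ≤ ηx / 2 * ℓ ^ 2)
    have h3 : ηx / 2 * ℓ ^ 2 * (ζ / ℓ) = ηx * ε ^ 2 * (1 / 12) := by
      rw [hζ]; field_simp; norm_num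
    have h4 := mul_le_mul_of_nonneg_left hσ (by positivity : 0 ≤ 3 / 16 * ηx)
    linarith
  have hsum : ηx / 2 * ∑ t ∈ Finset.range (T + 1), ∫ ω, ‖gradient (Phi f Y) (x t ω)‖ ^ 2 ∂P ≤
      ∫ ω, Phi f Y (x 0 ω) ∂P - ∫ ω, Phi f Y (x (T + 1) ω) ∂P +
        (T + 1) * (ηx * ε ^ 2 * (1 / 12 + 1 / 64)) := by
    rw [Finset.mul_sum, ← Finset.sum_range_sub' (fun t => ∫ ω, Phi f Y (x t ω) ∂P)]
    refine (Finset.sum_le_sum fun t _ => hstep t).trans_eq ?_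
    rw [Finset.sum_add_distrib, Finset.sum_const, Finset.card_range, nsmul_eq_mul]
    push_cast
    rfl
  have hgap : ∫ ω, Phi f Y (x 0 ω) ∂P - ∫ ω, Phi f Y (x (T + 1) ω) ∂P ≤ gap f Y x₀ := by
    refine sub_le_sub ?_ ?_
    · simp [hR.init]
    · calc ⨅ x, Phi f Y x = ∫ _, ⨅ x, Phi f Y x ∂P := by simp
        _ ≤ _ := integral_mono (integrable_const _)
          (h.integrable_Phi (hR.measurable_x _) (hX2 _)) fun ω => ciInf_le h.bddBelow _
  have hgap' : gap f Y x₀ ≤ ηx * ε ^ 2 / 4 * (T + 1) := by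
    have e : ηx * ε ^ 2 / 4 * (32 * (ℓ / μ * ℓ * gap f Y x₀ / ε ^ 2)) = gap f Y x₀ := by
      rw [hηx]; field_simp; norm_num
    rw [← e]
    gcongr
  rw [div_le_iff₀ (by positivity)]
  refine le_of_mul_le_mul_left ?_ (by positivity : 0 < ηx / 2)
  -- The gap takes 1/4 of ηε²(T + 1), the bias 1/12 and the noise 1/64; together they stay below the
  -- available 1/2.
  have : 0 ≤ (T + 1 : ℝ) * (ηx * ε ^ 2) := by positivity
  linarith

end Descent

/-! ### SGDmax with the ascent as max-oracle -/

section Implementation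

variable {m n : ℕ} {Ξ : Type*} {ℓ μ : ℝ} {f : Joint m n → ℝ} {Y : Set (Vec n)}
  {G : Joint m n → Ξ → Joint m n} {start : ℕ → Vec m → Vec n → Vec n}

theorem sgdmaxSGA_calls (G : Joint m n → Ξ → Joint m n) (Y : Set (Vec n)) (ηx ηy : ℝ)
    (M M' N : ℕ) (start : ℕ → Vec m → Vec n → Vec n) (x₀ : Vec m) (y₀ : Vec n)
    (s : ℕ → ℕ → ℕ → Ξ) (T : ℕ) :
    (sgdmaxSGA G Y ηx ηy M M' N start x₀ y₀ s T).calls = T * (N * M' + M) := by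
  induction T with
  | zero => simp [sgdmaxSGA]
  | succ T ih => simp [sgdmaxSGA, ih, sga_calls]; ring

variable [MeasurableSpace Ξ]

theorem measurable_sgdmaxSGA {α : Type*} {mα : MeasurableSpace α} (h : IsNSC ℓ μ f Y)
    (hG : Measurable (Function.uncurry G)) (hst : ∀ t, Measurable (Function.uncurry (start t)))
    (ηx ηy : ℝ) (M M' N : ℕ) (x₀ : Vec m) (y₀ : Vec n) {s : α → ℕ → ℕ → ℕ → Ξ} {T : ℕ}
    (hs : ∀ t < T, ∀ j i, Measurable fun a => s a t j i) :
    Measurable (fun a => (sgdmaxSGA G Y ηx ηy M M' N start x₀ y₀ (s a) T).x) ∧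
      Measurable (fun a => (sgdmaxSGA G Y ηx ηy M M' N start x₀ y₀ (s a) T).y) := by
  induction T with
  | zero => exact ⟨measurable_const, measurable_const⟩
  | succ T ih =>
    obtain ⟨hx, hy⟩ := ih fun t ht => hs t (ht.trans T.lt_succ_self)
    have hsT := hs T T.lt_succ_self
    have hr := measurable_sga h hG ηy (B := M') (N := N) hx ((hst T).comp (hx.prodMk hy))
      (s := fun a j => s a T (j + 1)) fun j _ i _ => hsT (j + 1) i
    have hb := measurable_miniBatch hG (M := M) (measurable_pt hx hr)
      (s := fun a => s a T 0) fun i _ => hsT 0 i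
    exact ⟨hx.sub ((measurable_xPart.comp hb).const_smul ηx), hr⟩

variable {Ω : Type*} [MeasurableSpace Ω] {P : Measure Ω} [IsProbabilityMeasure P]
  {𝒟 : Measure Ξ} [IsProbabilityMeasure 𝒟] {σ ηx ζ : ℝ} {M M' N : ℕ}

theorem isRun_sgdmaxSGA (h : IsNSC ℓ μ f Y) (hn : 0 < n) (hG : IsStochOracle 𝒟 σ f G)
    (hst : ∀ t, Measurable (Function.uncurry (start t))) (hstY : ∀ t x y, start t x y ∈ Y)
    {ξ : ℕ → ℕ → ℕ → Ω → Ξ} (hξ : IsIID P 𝒟 (fun a : ℕ × ℕ × ℕ => ξ a.1 a.2.1 a.2.2))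
    (hM : 0 < M) (hζ : 0 < ζ) (hM' : max (1 : ℝ) (2 * σ ^ 2 * (ℓ / μ) / (ℓ * ζ)) ≤ M')
    (hN : 32 * (ℓ / μ * max 1 (Real.log (ℓ * Metric.diam Y ^ 2 / ζ))) ≤ N) (x₀ : Vec m)
    (y₀ : Vec n) :
    IsRun P 𝒟 f Y G ℓ ηx ζ M x₀ (fun t i => ξ t 0 i)
      (fun t ω => (sgdmaxSGA G Y ηx (1 / ℓ) M M' N start x₀ y₀ (fun t' j i => ξ t' j i ω) t).x)
      (fun t ω =>
        (sgdmaxSGA G Y ηx (1 / ℓ) M M' N start x₀ y₀ (fun t' j i => ξ t' j i ω) (t + 1)).y) := by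
  set X : ℕ → Ω → Vec m := fun t ω =>
    (sgdmaxSGA G Y ηx (1 / ℓ) M M' N start x₀ y₀ (fun t' j i => ξ t' j i ω) t).x with hXdef
  -- Index shift: `W t` is y_{t-1}, the point the ascent may start from, and the oracle output y_t
  -- is `W (t + 1)`.
  set W : ℕ → Ω → Vec n := fun t ω =>
    (sgdmaxSGA G Y ηx (1 / ℓ) M M' N start x₀ y₀ (fun t' j i => ξ t' j i ω) t).y with hWdef
  have hWs : ∀ t ω, W (t + 1) ω = (sga G Y (1 / ℓ) M' (X t ω) (start t (X t ω) (W t ω))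
      (fun j i => ξ t (j + 1) i ω) N).1 := fun _ _ => rfl
  have hξm : ∀ t j i, Measurable (ξ t j i) := fun t j i => hξ.measurable (t, j, i)
  have hmeas : ∀ t, Measurable (X t) ∧ Measurable (W t) := fun t =>
    measurable_sgdmaxSGA h hG.measurable hst ηx (1 / ℓ) M M' N x₀ y₀ fun t' _ j i => hξm t' j i
  have hWY : ∀ t ω, W (t + 1) ω ∈ Y := fun t ω => by
    rw [hWs]; exact sga_mem h _ _ _ (hstY _ _ _) _ _
  have hpast : ∀ (S : Set (ℕ × ℕ × ℕ)) t, (∀ a : ℕ × ℕ × ℕ, a.1 < t → a ∈ S) →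
      Measurable[⨆ a ∈ S, MeasurableSpace.comap (ξ a.1 a.2.1 a.2.2) inferInstance] (X t) ∧
      Measurable[⨆ a ∈ S, MeasurableSpace.comap (ξ a.1 a.2.1 a.2.2) inferInstance] (W t) :=
    fun S t hS => measurable_sgdmaxSGA h hG.measurable hst ηx (1 / ℓ) M M' N x₀ y₀
      fun t' ht' j i => measurable_iSup_comap
        (ξ := fun a : ℕ × ℕ × ℕ => ξ a.1 a.2.1 a.2.2) (i := (t', j, i)) (hS _ ht')
  have hiid : ∀ t, IsIID P 𝒟 (fun i : Fin M => ξ t 0 i) := fun t =>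
    hξ.precomp (e := fun i : Fin M => (t, 0, (i : ℕ)))
      fun i j hij => by simpa [Fin.ext_iff] using hij
  have hfresh : ∀ t, IndepFun (fun ω => (X t ω, W (t + 1) ω))
      (fun ω (i : Fin M) => ξ t 0 i ω) P := fun t => by
    -- x_t and y_t use the samples of earlier iterations and those of iteration t with nonzero
    -- middle index; index 0 is reserved for the descent batch.
    have hd : Disjoint {a : ℕ × ℕ × ℕ | a.1 < t ∨ a.1 = t ∧ a.2.1 ≠ 0}
        {a : ℕ × ℕ × ℕ | a.1 = t ∧ a.2.1 = 0} := Set.disjoint_left.2 fun a h1 h2 => by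
      simp only [Set.mem_ofPred_eq] at h1 h2; omega
    obtain ⟨hx, hw⟩ := hpast {a : ℕ × ℕ × ℕ | a.1 < t ∨ a.1 = t ∧ a.2.1 ≠ 0} t
      fun a ha => Or.inl ha
    refine hξ.indepFun hd (hx.prodMk ?_) ?_
    · exact measurable_sga h hG.measurable _ hx ((hst t).comp (hx.prodMk hw))
        fun j _ i _ => measurable_iSup_comap (ξ := fun a : ℕ × ℕ × ℕ => ξ a.1 a.2.1 a.2.2)
          (i := (t, j + 1, i)) (Or.inr ⟨rfl, j.succ_ne_zero⟩)
    · exact @measurable_pi_lambda _ _ _ (_) _ _ fun i =>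
        measurable_iSup_comap (ξ := fun a : ℕ × ℕ × ℕ => ξ a.1 a.2.1 a.2.2)
          (i := (t, 0, (i : ℕ))) (S := {a : ℕ × ℕ × ℕ | a.1 = t ∧ a.2.1 = 0}) ⟨rfl, rfl⟩
  -- Square integrability is needed before the oracle conditions can be checked, so it is derived
  -- from freshness alone.
  have hX2 : ∀ t, MemLp (X t) 2 P := fun t => by
    induction t with
    | zero => exact memLp_const x₀
    | succ t ih =>
      exact memLp_descent_step h hG hM (hiid t) (hmeas t).1 ih (hmeas (t + 1)).2 (hWY t)
        (hfresh t) ηx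
  have hUm : ∀ t, Measurable fun ω => (X t ω, W t ω) := fun t => (hmeas t).1.prodMk (hmeas t).2
  have hVm : ∀ t, Measurable fun ω j i => ξ t (j + 1) i ω := fun t =>
    measurable_pi_lambda _ fun j => measurable_pi_lambda _ fun i => hξm t (j + 1) i
  have hUV : ∀ t, IndepFun (fun ω => (X t ω, W t ω)) (fun ω j i => ξ t (j + 1) i ω) P :=
    fun t => by
    have hd : Disjoint {a : ℕ × ℕ × ℕ | a.1 < t} {a : ℕ × ℕ × ℕ | a.1 = t} :=
      Set.disjoint_left.2 fun a h1 h2 => (ne_of_lt h1) h2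
    obtain ⟨hx, hw⟩ := hpast {a : ℕ × ℕ × ℕ | a.1 < t} t fun a ha => ha
    refine hξ.indepFun hd (hx.prodMk hw) ?_
    exact @measurable_pi_lambda _ _ _ (_) _ _ fun j => @measurable_pi_lambda _ _ _ (_) _ _ fun i =>
      measurable_iSup_comap (ξ := fun a : ℕ × ℕ × ℕ => ξ a.1 a.2.1 a.2.2)
        (i := (t, j + 1, i)) (S := {a : ℕ × ℕ × ℕ | a.1 = t}) rfl
  have hiid' : ∀ t, IsIID P 𝒟 (fun a : ℕ × ℕ => ξ t (a.1 + 1) a.2) := fun t =>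
    hξ.precomp (e := fun a : ℕ × ℕ => (t, a.1 + 1, a.2)) fun a b hab => by
      simpa [Prod.ext_iff] using hab
  have hacc : ∀ t (u : Vec m × Vec n), _ := fun t u =>
    sga_accuracy (P := P) (ξ := fun j i => ξ t (j + 1) i) h hn hG hζ hM' u.1 (hstY t u.1 u.2)
      (hiid' t) hN
  have hYm : ∀ t, Measurable fun p : (Vec m × Vec n) × (ℕ → ℕ → Ξ) =>
      (sga G Y (1 / ℓ) M' p.1.1 (start t p.1.1 p.1.2) p.2 N).1 := fun t =>
    measurable_sga h hG.measurable _ (measurable_fst.comp measurable_fst)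
      ((hst t).comp measurable_fst) fun j _ i _ =>
        (measurable_pi_apply i).comp ((measurable_pi_apply j).comp measurable_snd)
  have hyS : ∀ t, Measurable fun ω => yStar f Y (X t ω) := fun t =>
    h.continuous_yStar.measurable.comp (hmeas t).1
  refine ⟨hiid, hfresh, fun t => (hmeas t).1, fun t => (hmeas (t + 1)).2, hWY, fun t => ?_,
    fun t => ?_, fun ω => rfl, fun t ω => rfl⟩
  · exact ae_le_condExp_of_indepFun (hUV t) (hUm t) (hVm t)
      (F := fun p => f (pt p.1.1 (sga G Y (1 / ℓ) M' p.1.1 (start t p.1.1 p.1.2) p.2 N).1))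
      (h.continuous.measurable.comp (measurable_pt (measurable_fst.comp measurable_fst) (hYm t)))
      (h.smooth.integrable_comp (h.memLp_pt (hX2 t) (hmeas (t + 1)).2 (hWY t)))
      measurable_fst (g := fun x => Phi f Y x - ζ)
      ((h.continuous_Phi hn).measurable.sub_const ζ)
      ((h.integrable_Phi (hmeas t).1 (hX2 t)).sub (integrable_const ζ))
      fun u => (hacc t u).1
  · have hd2 : MemLp (fun ω => W (t + 1) ω - yStar f Y (X t ω)) 2 P :=
      (h.memLp_comp (φ := id) continuous_id (hmeas (t + 1)).2 (hWY t) 2).sub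
        (h.memLp_comp (φ := id) continuous_id (hyS t) (fun ω => h.yStar_mem _) 2)
    have I : Integrable (fun ω => ‖W (t + 1) ω - yStar f Y (X t ω)‖ ^ 2) P :=
      (memLp_two_iff_integrable_sq_norm hd2.1).1 hd2
    -- The upper bound on the distance is the lower bound for its negative.
    have key := ae_le_condExp_of_indepFun (hUV t) (hUm t) (hVm t)
      (F := fun p => -‖(sga G Y (1 / ℓ) M' p.1.1 (start t p.1.1 p.1.2) p.2 N).1 -
        yStar f Y p.1.1‖ ^ 2)
      ((((hYm t).sub (h.continuous_yStar.measurable.comp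
        (measurable_fst.comp measurable_fst))).norm.pow_const 2).neg)
      I.neg measurable_fst (g := fun _ => -(ζ / ℓ)) measurable_const (integrable_const _)
      fun u => by
        rw [integral_neg]
        exact neg_le_neg (hacc t u).2
    filter_upwards [key, condExp_neg (μ := P) (fun ω => ‖W (t + 1) ω - yStar f Y (X t ω)‖ ^ 2)
      (MeasurableSpace.comap (X t) inferInstance)] with ω h1 h2
    have h3 : -(ζ / ℓ) ≤ (P[-fun ω => ‖W (t + 1) ω - yStar f Y (X t ω)‖ ^ 2 |
      MeasurableSpace.comap (X t) inferInstance]) ω := h1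
    rw [h2] at h3
    exact neg_le_neg_iff.1 h3

end Implementation

/-! ### Constants and the main theorem -/

/-- The argument on the left is 6(ℓD/ε)², so its logarithm is at most 2 + 2 log(ℓD/ε) when D > 0;
for D = 0 it is 0. -/
theorem log_accuracy_le {ℓ D ε : ℝ} (hℓ : 0 < ℓ) (hD : 0 ≤ D) (hε : 0 < ε) :
    max 1 (Real.log (ℓ * D ^ 2 / (ε ^ 2 / (6 * ℓ)))) ≤ 4 * max 1 (Real.log (ℓ * D / ε)) := by
  have h1 : 1 ≤ max 1 (Real.log (ℓ * D / ε)) := le_max_left _ _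
  have h2 : Real.log (ℓ * D / ε) ≤ max 1 (Real.log (ℓ * D / ε)) := le_max_right _ _
  refine max_le (by linarith) ?_
  rcases hD.eq_or_lt with h0 | h0
  · rw [← h0]; norm_num
  · have e : ℓ * D ^ 2 / (ε ^ 2 / (6 * ℓ)) = 6 * (ℓ * D / ε) ^ 2 := by field_simp
    rw [e, Real.log_mul (by norm_num) (by positivity), Real.log_pow]
    have h6 : Real.log 6 ≤ 2 := by
      rw [Real.log_le_iff_le_exp (by norm_num)]
      have := Real.exp_one_gt_d9
      have e2 : Real.exp 2 = Real.exp 1 * Real.exp 1 := by rw [← Real.exp_add]; norm_num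
      rw [e2]; nlinarith
    push_cast
    linarith

theorem natCeil_le_of_one_le {a : ℝ} (ha : 1 ≤ a) : (⌈a⌉₊ : ℝ) ≤ 2 * a := by
  have := Nat.ceil_lt_add_one (zero_le_one.trans ha)
  linarith

end SGDmax

theorem mainTheorem9 :
    ∃ C C' : ℝ, 0 < C ∧ 0 < C' ∧
      ∀ {m n : ℕ} {Ω Ξ : Type*} [MeasurableSpace Ω] [MeasurableSpace Ξ]
        (P : MeasureTheory.Measure Ω) [MeasureTheory.IsProbabilityMeasure P]
        (𝒟 : MeasureTheory.Measure Ξ) [MeasureTheory.IsProbabilityMeasure 𝒟]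
        (f : SGDmax.Joint m n → ℝ) (Y : Set (SGDmax.Vec n))
        (G : SGDmax.Joint m n → Ξ → SGDmax.Joint m n)
        (ℓ μ σ ε κ D Δ ηx ηy ζ : ℝ) (x₀ : SGDmax.Vec m) (M M' : ℕ),
        0 < n → SGDmax.IsNSC ℓ μ f Y → 0 ≤ σ → SGDmax.IsStochOracle 𝒟 σ f G → 0 < ε →
        κ = ℓ / μ → D = Metric.diam Y → Δ = SGDmax.gap f Y x₀ →
        ηx = 1 / (8 * κ * ℓ) → ηy = 1 / ℓ → ζ = ε ^ 2 / (6 * ℓ) →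
        M = ⌈max 1 (12 * κ * σ ^ 2 / ε ^ 2)⌉₊ →
        M' = ⌈max 1 (2 * σ ^ 2 * κ / (ℓ * ζ))⌉₊ →
        -- iteration complexity of SGDmax
        (∀ (ξ : ℕ → ℕ → Ω → Ξ) (x : ℕ → Ω → SGDmax.Vec m) (y : ℕ → Ω → SGDmax.Vec n),
          SGDmax.IsRun P 𝒟 f Y G ℓ ηx ζ M x₀ ξ x y →
          ∀ T : ℕ, C * (κ * ℓ * Δ / ε ^ 2) ≤ T + 1 →
            SGDmax.ReturnsStationary P (SGDmax.Phi f Y) ε x T) ∧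
        -- realization of the max-oracle, for every accuracy `z`
        (∀ z : ℝ, 0 < z → ∀ B : ℕ, B = ⌈max 1 (2 * σ ^ 2 * κ / (ℓ * z))⌉₊ →
          ∀ (x : SGDmax.Vec m) (y₀ : SGDmax.Vec n), y₀ ∈ Y →
          ∀ ξ : ℕ → ℕ → Ω → Ξ, SGDmax.IsIID P 𝒟 (fun a : ℕ × ℕ => ξ a.1 a.2) →
          ∀ N : ℕ, N = ⌈C * (κ * max 1 (Real.log (ℓ * D ^ 2 / z)))⌉₊ →
            ∀ yN : Ω → SGDmax.Vec n,
            (∀ ω, yN ω = (SGDmax.sga G Y ηy B x y₀ (fun j i => ξ j i ω) N).1) →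
            Measurable yN ∧ (∀ ω, yN ω ∈ Y) ∧
            SGDmax.Phi f Y x - z ≤ ∫ ω, f (SGDmax.pt x (yN ω)) ∂P ∧
            ∫ ω, ‖yN ω - SGDmax.yStar f Y x‖ ^ 2 ∂P ≤ z / ℓ ∧
            ∀ ω, ((SGDmax.sga G Y ηy B x y₀ (fun j i => ξ j i ω) N).2 : ℝ) ≤
              C' * (κ * max 1 (Real.log (ℓ * D ^ 2 / z)) *
                max 1 (2 * σ ^ 2 * κ / (ℓ * z)))) ∧
        -- SGDmax with this max-oracle: correctness and total stochastic gradient complexity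
        (∀ (start : ℕ → SGDmax.Vec m → SGDmax.Vec n → SGDmax.Vec n) (y₀ : SGDmax.Vec n),
          (∀ t, Measurable (Function.uncurry (start t))) → (∀ t x y, start t x y ∈ Y) →
          ∀ ξ : ℕ → ℕ → ℕ → Ω → Ξ,
          SGDmax.IsIID P 𝒟 (fun a : ℕ × ℕ × ℕ => ξ a.1 a.2.1 a.2.2) →
          ∀ N : ℕ, N = ⌈C * (κ * max 1 (Real.log (ℓ * D ^ 2 / ζ)))⌉₊ →
            ∀ S : ℕ → Ω → SGDmax.State m n,
            (∀ t ω, S t ω = SGDmax.sgdmaxSGA G Y ηx ηy M M' N start x₀ y₀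
              (fun t' j i => ξ t' j i ω) t) →
            SGDmax.IsRun P 𝒟 f Y G ℓ ηx ζ M x₀ (fun t i => ξ t 0 i)
              (fun t ω => (S t ω).x) (fun t ω => (S (t + 1) ω).y) ∧
            ∀ T : ℕ, T = ⌊C * (κ * ℓ * Δ / ε ^ 2)⌋₊ →
              SGDmax.ReturnsStationary P (SGDmax.Phi f Y) ε (fun t ω => (S t ω).x) T ∧
              ∀ ω, ((S T ω).calls : ℝ) ≤
                C' * (κ ^ 2 * ℓ * Δ / ε ^ 2 * max 1 (Real.log (ℓ * D / ε)) *
                  max 1 (κ * σ ^ 2 / ε ^ 2))) := by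
  -- 102144 = 32 · 3192 and 3192 = 132 · 24 + 24. Here 132 = 33 · 4 comes from rounding up 32κL and
  -- from the change of logarithm, and 24 = 2 · 12 from rounding up the batch sizes.
  refine ⟨32, 102144, by norm_num, by norm_num, ?_⟩
  intro m n Ω Ξ _ _ P _ 𝒟 _ f Y G ℓ μ σ ε κ D Δ ηx ηy ζ x₀ M M' hn h hσ hG hε hκ hD hΔ hηx hηy hζ
    hM hM'
  have hμ := h.mu_pos
  have hℓ := hμ.trans_le (h.mu_le hn)
  have hκ1 : 1 ≤ κ := hκ ▸ (one_le_div hμ).2 (h.mu_le hn)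
  have hζ0 : 0 < ζ := by rw [hζ]; positivity
  have hMle : max (1 : ℝ) (12 * κ * σ ^ 2 / ε ^ 2) ≤ M := hM ▸ Nat.le_ceil _
  have hM0 : 0 < M := by exact_mod_cast (le_max_left _ _).trans hMle
  have hN_le : ∀ {L : ℝ}, 1 ≤ L → (⌈32 * (κ * L)⌉₊ : ℝ) ≤ 33 * (κ * L) := fun {L} hL => by
    have h1 : 1 ≤ κ * L := one_le_mul_of_one_le_of_one_le hκ1 hL
    have := Nat.ceil_lt_add_one (a := 32 * (κ * L)) (by positivity)
    linarith
  refine ⟨fun ξ x y hR T hT => ?_, ?_, ?_⟩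
  · subst hκ hΔ
    exact hR.returnsStationary h hn hG hε hηx hζ hMle hT
  · intro z hz B hB x y₀ hy ξ hξ N hN yN hyN
    obtain rfl : yN = _ := funext hyN
    have hN' : 32 * (κ * max 1 (Real.log (ℓ * D ^ 2 / z))) ≤ N := hN ▸ Nat.le_ceil _
    have hB' : max (1 : ℝ) (2 * σ ^ 2 * κ / (ℓ * z)) ≤ B := hB ▸ Nat.le_ceil _
    refine ⟨SGDmax.measurable_sga h hG.measurable _ measurable_const measurable_const
        fun j _ i _ => hξ.measurable (j, i), fun ω => SGDmax.sga_mem h _ _ _ hy _ _, ?_⟩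
    rw [← and_assoc]
    constructor
    · subst hκ hD hηy
      exact SGDmax.sga_accuracy h hn hG hz hB' x hy hξ hN'
    · intro ω
      rw [SGDmax.sga_calls]
      push_cast
      have h1 := hN_le (le_max_left 1 (Real.log (ℓ * D ^ 2 / z)))
      have h2 := SGDmax.natCeil_le_of_one_le (le_max_left 1 (2 * σ ^ 2 * κ / (ℓ * z)))
      rw [← hN] at h1
      rw [← hB] at h2
      set L := max 1 (Real.log (ℓ * D ^ 2 / z))
      set b := max 1 (2 * σ ^ 2 * κ / (ℓ * z))
      have hL0 : 0 ≤ κ * L * b := by positivity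
      calc (N : ℝ) * B ≤ 33 * (κ * L) * (2 * b) := by gcongr
        _ ≤ 102144 * (κ * L * b) := by linarith
  · intro start y₀ hst hstY ξ hξ N hN S hS
    obtain rfl : S = _ := funext fun t => funext (hS t)
    have hN' : 32 * (κ * max 1 (Real.log (ℓ * D ^ 2 / ζ))) ≤ N := hN ▸ Nat.le_ceil _
    have hM'le : max (1 : ℝ) (2 * σ ^ 2 * κ / (ℓ * ζ)) ≤ M' := hM' ▸ Nat.le_ceil _
    have hR : SGDmax.IsRun P 𝒟 f Y G ℓ ηx ζ M x₀ (fun t i => ξ t 0 i)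
        (fun t ω => (SGDmax.sgdmaxSGA G Y ηx ηy M M' N start x₀ y₀
          (fun t' j i => ξ t' j i ω) t).x)
        (fun t ω => (SGDmax.sgdmaxSGA G Y ηx ηy M M' N start x₀ y₀
          (fun t' j i => ξ t' j i ω) (t + 1)).y) := by
      subst hκ hD hηy
      exact SGDmax.isRun_sgdmaxSGA h hn hG hst hstY hξ hM0 hζ0 hM'le hN' x₀ y₀
    refine ⟨hR, fun T hT => ⟨?_, fun ω => ?_⟩⟩
    · have hT' : 32 * (κ * ℓ * Δ / ε ^ 2) ≤ T + 1 := hT ▸ (Nat.lt_floor_add_one _).le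
      subst hκ hΔ
      exact hR.returnsStationary h hn hG hε hηx hζ hMle hT'
    · have hΔ0 : 0 ≤ Δ := hΔ ▸ h.gap_nonneg x₀
      -- Rounding down leaves no additive 1, so the bound is proportional to Δ even for Δ = 0, while
      -- T + 1 still exceeds the threshold for stationarity.
      have hT' : (T : ℝ) ≤ 32 * (κ * ℓ * Δ / ε ^ 2) := hT ▸ Nat.floor_le (by positivity)
      rw [SGDmax.sgdmaxSGA_calls]
      push_cast
      have h1 := hN_le (le_max_left 1 (Real.log (ℓ * D ^ 2 / ζ)))
      have h2 := SGDmax.natCeil_le_of_one_le (le_max_left 1 (2 * σ ^ 2 * κ / (ℓ * ζ)))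
      have h3 := SGDmax.natCeil_le_of_one_le (le_max_left 1 (12 * κ * σ ^ 2 / ε ^ 2))
      have h4 := SGDmax.log_accuracy_le hℓ (hD ▸ Metric.diam_nonneg : 0 ≤ D) hε
      rw [← hN] at h1
      rw [← hM'] at h2
      rw [← hM] at h3
      rw [← hζ] at h4
      -- For z = ζ the ascent batch size coincides with the descent batch size.
      have e : 2 * σ ^ 2 * κ / (ℓ * ζ) = 12 * κ * σ ^ 2 / ε ^ 2 := by
        rw [hζ]; field_simp; ring
      have h5 : max 1 (12 * κ * σ ^ 2 / ε ^ 2) ≤ 12 * max 1 (κ * σ ^ 2 / ε ^ 2) := by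
        have a1 : 1 ≤ max 1 (κ * σ ^ 2 / ε ^ 2) := le_max_left _ _
        have a2 : κ * σ ^ 2 / ε ^ 2 ≤ max 1 (κ * σ ^ 2 / ε ^ 2) := le_max_right _ _
        refine max_le (by linarith) ?_
        rw [show 12 * κ * σ ^ 2 / ε ^ 2 = 12 * (κ * σ ^ 2 / ε ^ 2) by ring]
        linarith
      rw [e] at h2
      have hL1 : 1 ≤ max 1 (Real.log (ℓ * D / ε)) := le_max_left _ _
      have hb1 : 1 ≤ max 1 (κ * σ ^ 2 / ε ^ 2) := le_max_left _ _
      set L := max 1 (Real.log (ℓ * D / ε))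
      set b := max 1 (κ * σ ^ 2 / ε ^ 2)
      have hNκ : (N : ℝ) ≤ 132 * (κ * L) := by
        have := mul_le_mul_of_nonneg_left h4 (zero_le_one.trans hκ1)
        linarith
      have hκL : b ≤ κ * L * b :=
        le_mul_of_one_le_left (by positivity) (one_le_mul_of_one_le_of_one_le hκ1 hL1)
      have hsum : (N : ℝ) * M' + M ≤ 3192 * (κ * L * b) := by
        calc (N : ℝ) * M' + M ≤ 132 * (κ * L) * (24 * b) + 24 * b := by
              gcongr <;> linarith
          _ ≤ _ := by linarith
      calc (T : ℝ) * (N * M' + M)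
          ≤ 32 * (κ * ℓ * Δ / ε ^ 2) * (3192 * (κ * L * b)) := by gcongr
        _ = _ := by ring
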